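/- Let $R$ be a commutative noetherian ring. For an $R$-algebra $A$ let $A^\circ=\{f\in A^*\mid AfA \text{ is finitely generated over } R\}$, where $A^*=\mathrm{Hom}_R(A,R)$ has the bimodule structure $(afb)(x)=f(bxa)$; $A$ is called an $\alpha$-algebra if $A^\circ\subseteq R^A$ is a pure $R$-submodule, and then $A^\circ$ is an $R$-coalgebra with $f(xy)=\sum f_1(x)f_2(y)$ and $\varepsilon(f)=f(1)$ (a bialgebra under convolution, if $A$ is a bialgebra). A pairing $\langle -,-\rangle:B\times D\to R$ of an $R$-algebra $B$ and an $R$-coalgebra $D$ whose induced map $B\to D^*$ is an algebra morphism satisfies the $\alpha$-condition if for every $R$-module $M$ the map $M\otimes_R D\to\mathrm{Hom}_R(B,M)$, $m\otimes d\mapsto[b\mapsto m\langle b,d\rangle]$, is injective. For a left $B$-module $N$ put $\mathrm{Rat}^D({}_BN)=\{n\in N\mid \exists \sum n_i\otimes d_i\in N\otimes_R D:\ bn=\sum n_i\langle b,d_i\rangle \text{ for all } b\in B\}$. Let $(H,A,C)$ be a right-right Doi-Koppinen structure over $R$: an $R$-bialgebra $H$, a right $H$-comodule algebra $A$ and a right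 $H$-module coalgebra $C$. Let $\mathcal M(H)_A^C$ be the category of right $A$-modules and right $C$-comodules $M$ with $\varrho(ma)=\sum m_{<0>}a_{<0>}\otimes m_{<1>}a_{<1>}$, with the $A$-linear $C$-colinear maps as morphisms. Assume that $H$ and $A$ are $\alpha$-algebras. Put $C^0=\mathrm{Rat}^{H^\circ}({}_HC^*)$, with $(hg)(c)=g(ch)$; it is an algebra under convolution, and $(H^\circ,C^0,A^\circ)$ is again a right-right Doi-Koppinen structure, with $H^\circ$-coaction on $C^0$ given by $\sum g_{<0>}\,g_{<1>}(h)=hg$ and $H^\circ$-action on $A^\circ$ given by $(fu)(a)=\sum f(a_{<0>})u(a_{<1>})$. 1. There is a contravariant functor $(-)^0:\mathcal M(H)_A^C\to\mathcal M(H^\circ)_{C^0}^{A^\circ}$, $M\mapsto M^0=\mathrm{Rat}^{A^\circ}({}_AM^*)$, where $(af)(m)=f(ma)$. On $M^0$ the $C^0$-action is $(fg)(m)=\sum f(m_{<0>})g(m_{<1>})$ and the $A^\circ$-coaction is given by $\sum f_{<0>}\,f_{<1>}(a)=af$; a morphism $\varphi:M\to N$ is sent to $N^0\to M^0$, $f\mapsto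 f\circ\varphi$. 2. If the pairing $(C^0,C)$, $\langle g,c\rangle=g(c)$, satisfies the $\alpha$-condition, then there is a contravariant functor $(-)^\Diamond:\mathcal M(H^\circ)_{C^0}^{A^\circ}\to\mathcal M(H)_A^C$, $K\mapsto K^\Diamond=\mathrm{Rat}^C({}_{C^0}K^*)$, where $(gf)(k)=f(kg)$. On $K^\Diamond$ the $A$-action is $(fa)(k)=\sum f(k_{<0>})k_{<1>}(a)$ and the $C$-coaction is given by $\sum f_{<0>}\,g(f_{<1>})=gf$; a morphism $\varphi:K\to L$ is sent to $L^\Diamond\to K^\Diamond$, $f\mapsto f\circ\varphi$. Moreover the contravariant functors $(-)^0$ and $(-)^\Diamond$ are right adjoint to each other, that is, there is a bijection $\mathrm{Hom}_{\mathcal M(H)_A^C}(M,K^\Diamond)\cong\mathrm{Hom}_{\mathcal M(H^\circ)_{C^0}^{A^\circ}}(K,M^0)$ natural in $M$ and $K$. -/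

import Mathlib

open scoped TensorProduct
open CategoryTheory

universe u

/-! ### Pairings, the α-condition, rational submodules -/

section Pairings

variable {R : Type u} [CommRing R] {A C : Type u} [AddCommMonoid A] [Module R A]
  [AddCommMonoid C] [Module R C]

/-- For a bilinear pairing `κ : A × C → R`, written `<a, c>`, and an `R`-module `M`, the map
`M ⊗ C → Hom(A, M)`, `m ⊗ c ↦ [a ↦ <a, c> m]`. -/
noncomputable def alphaMap (κ : A →ₗ[R] C →ₗ[R] R) (M : Type u) [AddCommMonoid M] [Module R M] :
    M ⊗[R] C →ₗ[R] (A →ₗ[R] M) :=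
  TensorProduct.lift ((LinearMap.smulRightₗ ∘ₗ κ.flip).flip)

@[simp] theorem alphaMap_tmul (κ : A →ₗ[R] C →ₗ[R] R) (M : Type u) [AddCommMonoid M] [Module R M]
    (m : M) (c : C) (a : A) : alphaMap κ M (m ⊗ₜ c) a = κ a c • m := rfl

/-- The α-condition for a pairing: all the maps `alphaMap κ M` are injective. -/
def AlphaCondition (κ : A →ₗ[R] C →ₗ[R] R) : Prop :=
  ∀ (M : Type u) [AddCommGroup M] [Module R M], Function.Injective (alphaMap κ M)

/-- For a left action `act` of `A` on `N`, the rational submodule `Rat^C(_A N)`: the elements `n`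
for which there is `∑ nᵢ ⊗ cᵢ ∈ N ⊗ C` with `a n = ∑ nᵢ <a, cᵢ>` for all `a ∈ A`, i.e. the
preimage of (the image of) `N ⊗ C` under the canonical map `N → Hom(A, N)`. -/
noncomputable def ratSubmodule (κ : A →ₗ[R] C →ₗ[R] R) {N : Type u} [AddCommMonoid N] [Module R N]
    (act : A →ₗ[R] N →ₗ[R] N) : Submodule R N :=
  (LinearMap.range (alphaMap κ N)).comap act.flip

/-- The left action of `A` on `M^*` induced by a right action of `A` on `M`:
`(a f)(m) = f (m a)`. -/
noncomputable def dualAction {M : Type u} [AddCommMonoid M] [Module R M]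
    (act : M →ₗ[R] A →ₗ[R] M) : A →ₗ[R] Module.Dual R M →ₗ[R] Module.Dual R M :=
  Module.Dual.transpose ∘ₗ act.flip

@[simp] theorem dualAction_apply {M : Type u} [AddCommMonoid M] [Module R M]
    (act : M →ₗ[R] A →ₗ[R] M) (a : A) (f : Module.Dual R M) (m : M) :
    dualAction act a f m = f (act m a) := rfl

theorem AlphaCondition.injective {κ : A →ₗ[R] C →ₗ[R] R} (hκ : AlphaCondition κ) {M : Type u}
    [AddCommMonoid M] [Module R M] : Function.Injective (alphaMap κ M) :=
  letI := Module.addCommMonoidToAddCommGroup R (M := M)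
  hκ M

/-- A linear map lifted along an injective linear map. -/
noncomputable def linearChoice {V T W : Type u} [AddCommMonoid V] [Module R V] [AddCommMonoid T]
    [Module R T] [AddCommMonoid W] [Module R W] (α : T →ₗ[R] W) (hα : Function.Injective α)
    (F : V →ₗ[R] W) (h : ∀ v, ∃ t, α t = F v) : V →ₗ[R] T where
  toFun v := Classical.choose (h v)
  map_add' v w := hα <|
    (Classical.choose_spec (h (v + w))).trans <| (map_add F v w).trans <|
      (congrArg₂ (· + ·) (Classical.choose_spec (h v)) (Classical.choose_spec (h w))).symm.trans
        (map_add α _ _).symm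
  map_smul' r v := hα <|
    (Classical.choose_spec (h (r • v))).trans <| (map_smul F r v).trans <|
      (congrArg (r • ·) (Classical.choose_spec (h v))).symm.trans (map_smul α _ _).symm

theorem linearChoice_spec {V T W : Type u} [AddCommMonoid V] [Module R V] [AddCommMonoid T]
    [Module R T] [AddCommMonoid W] [Module R W] (α : T →ₗ[R] W) (hα : Function.Injective α)
    (F : V →ₗ[R] W) (h : ∀ v, ∃ t, α t = F v) (v : V) : α (linearChoice α hα F h v) = F v :=
  Classical.choose_spec (h v)

theorem alphaMap_rTensor {M N : Type u} [AddCommMonoid M] [Module R M] [AddCommMonoid N]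
    [Module R N] (κ : A →ₗ[R] C →ₗ[R] R) (g : M →ₗ[R] N) (t : M ⊗[R] C) (a : A) :
    alphaMap κ N (g.rTensor C t) a = g (alphaMap κ M t a) := by
  induction t with
  | zero => simp
  | tmul m c => simp
  | add x y hx hy => simp [hx, hy]

/-- If `t ∈ N ⊗ C` represents a map `A → N` with values in a submodule `V`, and the α-condition
holds, then the map is represented by an element of `V ⊗ C`. -/
theorem exists_alphaMap_eq {κ : A →ₗ[R] C →ₗ[R] R} (hκ : AlphaCondition κ) {N : Type u}
    [AddCommGroup N] [Module R N] (V : Submodule R N) (F : A →ₗ[R] V) (t : N ⊗[R] C)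
    (h : ∀ a, alphaMap κ N t a = F a) : ∃ s, alphaMap κ V s = F := by
  letI := Module.addCommMonoidToAddCommGroup R (M := C)
  have hex : Function.Exact (V.subtype.rTensor C) (V.mkQ.rTensor C) :=
    rTensor_exact C (LinearMap.exact_subtype_mkQ V) (Submodule.mkQ_surjective _)
  have h0 : V.mkQ.rTensor C t = 0 := hκ.injective <| by
    ext a
    rw [alphaMap_rTensor, h]
    simp
  obtain ⟨s, rfl⟩ := (hex t).1 h0
  refine ⟨s, ?_⟩
  ext a
  rw [← h, alphaMap_rTensor]
  rfl

end Pairings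

/-! ### The finite dual and α-algebras -/

section FiniteDual

variable (R : Type u) [CommRing R] (A : Type u) [Ring A] [Algebra R A]

/-- The regular bimodule structure of `A^*`: `(a f b)(x) = f (b x a)`. -/
noncomputable def biTranslate (a b : A) : Module.Dual R A →ₗ[R] Module.Dual R A :=
  Module.Dual.transpose (LinearMap.mulLeft R b ∘ₗ LinearMap.mulRight R a)

@[simp] theorem biTranslate_apply (a b : A) (f : Module.Dual R A) (x : A) :
    biTranslate R A a b f x = f (b * (x * a)) := rfl

/-- The `A`-subbimodule `A f A` of `A^*` generated by `f`, as an `R`-module. -/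
noncomputable def subbimoduleSpan (f : Module.Dual R A) : Submodule R (Module.Dual R A) :=
  Submodule.span R (Set.range fun p : A × A => biTranslate R A p.1 p.2 f)

/-- The finite dual `A° = {f ∈ A^* | A f A is finitely generated over R}`. -/
noncomputable def finiteDual [IsNoetherianRing R] : Submodule R (Module.Dual R A) where
  carrier := {f | (subbimoduleSpan R A f).FG}
  zero_mem' := by
    have : subbimoduleSpan R A (0 : Module.Dual R A) = ⊥ := by
      simp [subbimoduleSpan]
    simpa [this] using Submodule.fg_bot
  add_mem' := by
    intro f g hf hg
    have hle : subbimoduleSpan R A (f + g) ≤ subbimoduleSpan R A f ⊔ subbimoduleSpan R A g := by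
      refine Submodule.span_le.2 ?_
      rintro _ ⟨p, rfl⟩
      simp only [map_add]
      exact Submodule.add_mem_sup (Submodule.subset_span ⟨p, rfl⟩) (Submodule.subset_span ⟨p, rfl⟩)
    exact Submodule.FG.of_le (Submodule.FG.sup hf hg) hle
  smul_mem' := by
    intro r f hf
    have hle : subbimoduleSpan R A (r • f) ≤ subbimoduleSpan R A f := by
      refine Submodule.span_le.2 ?_
      rintro _ ⟨p, rfl⟩
      simp only [map_smul]
      exact Submodule.smul_mem _ _ (Submodule.subset_span ⟨p, rfl⟩)
    exact Submodule.FG.of_le hf hle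

/-- `A` is an α-algebra: `A° ⊆ R^A` is pure, i.e. `A° ⊗ N → R^A ⊗ N` is injective for all `N`. -/
class IsAlphaAlgebra [IsNoetherianRing R] : Prop where
  pure : ∀ (N : Type u) [AddCommGroup N] [Module R N],
    Function.Injective
      (LinearMap.rTensor N (LinearMap.ltoFun R A R R ∘ₗ (finiteDual R A).subtype))

/-- The pairing between `A` and `A°`, `<a, f> = f a`. -/
noncomputable def finiteDualPairing [IsNoetherianRing R] : A →ₗ[R] finiteDual R A →ₗ[R] R :=
  (finiteDual R A).subtype.flip

variable {R A}

@[simp] theorem finiteDualPairing_apply [IsNoetherianRing R] (a : A) (f : finiteDual R A) :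
    finiteDualPairing R A a f = (f : Module.Dual R A) a := rfl

theorem biTranslate_mem [IsNoetherianRing R] {f : Module.Dual R A} (hf : f ∈ finiteDual R A)
    (a b : A) : biTranslate R A a b f ∈ finiteDual R A := by
  change (subbimoduleSpan R A _).FG
  refine Submodule.FG.of_le (T := subbimoduleSpan R A f) hf (Submodule.span_le.2 ?_)
  rintro _ ⟨p, rfl⟩
  refine Submodule.subset_span ⟨(p.1 * a, b * p.2), ?_⟩
  ext x
  simp [mul_assoc]

/-- The left `A`-action on `A°`, `(a f)(x) = f (x a)`. -/
noncomputable def leftTranslate [IsNoetherianRing R] : A →ₗ[R] finiteDual R A →ₗ[R] finiteDual R A :=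
  LinearMap.mk₂ R (fun a f => ⟨biTranslate R A a 1 f.1, biTranslate_mem f.2 a 1⟩)
    (fun a a' f => Subtype.ext <| by ext x; simp [mul_add])
    (fun r a f => Subtype.ext <| by ext x; simp)
    (fun a f f' => Subtype.ext <| by ext x; simp)
    (fun r a f => Subtype.ext <| by ext x; simp)

@[simp] theorem leftTranslate_apply [IsNoetherianRing R] (a : A) (f : finiteDual R A) (x : A) :
    (leftTranslate a f : Module.Dual R A) x = (f : Module.Dual R A) (x * a) := by
  simp [leftTranslate]

/-- The canonical map `R^X ⊗ N → N^X`. -/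
noncomputable def piTensorEval (X N : Type u) [AddCommGroup N] [Module R N] :
    (X → R) ⊗[R] N →ₗ[R] (X → N) :=
  TensorProduct.lift (LinearMap.mk₂ R (fun φ n x => φ x • n)
    (fun φ φ' n => by ext x; simp [add_smul]) (fun r φ n => by ext x; simp [mul_smul])
    (fun φ n n' => by ext x; simp) (fun r φ n => by ext x; exact smul_comm _ _ _))

@[simp] theorem piTensorEval_tmul (X N : Type u) [AddCommGroup N] [Module R N] (φ : X → R) (n : N)
    (x : X) : piTensorEval X N (φ ⊗ₜ[R] n) x = φ x • n := rfl

/-- Over a noetherian ring, `R^X ⊗ N → N^X` is injective. -/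
theorem piTensorEval_injective [IsNoetherianRing R] (X N : Type u) [AddCommGroup N] [Module R N] :
    Function.Injective (piTensorEval (R := R) X N) := by
  rw [injective_iff_map_eq_zero]
  intro t ht
  obtain ⟨k, φ, n, rfl⟩ := TensorProduct.exists_sum_tmul_eq t
  let K : Submodule R (Fin k → R) := LinearMap.ker (Fintype.linearCombination R n)
  obtain ⟨l, r, hr⟩ := Submodule.fg_iff_exists_fin_generating_family.1 (IsNoetherian.noetherian K)
  have hmem : ∀ x, (fun i => φ i x) ∈ Submodule.span R (Set.range r) := by
    intro x
    rw [hr]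
    have := congrFun ht x
    simpa [K, Fintype.linearCombination_apply, LinearMap.mem_ker] using this
  choose c hc using fun x => (Submodule.mem_span_range_iff_exists_fun R).1 (hmem x)
  have hφ : ∀ i, φ i = ∑ j, r j i • (fun x => c x j) := by
    intro i
    ext x
    have := congrFun (hc x) i
    simp only [Finset.sum_apply, Pi.smul_apply, smul_eq_mul] at this ⊢
    rw [← this]
    exact Finset.sum_congr rfl fun j _ => mul_comm _ _
  have hker : ∀ j, ∑ i, r j i • n i = 0 := by
    intro j
    have : r j ∈ K := hr ▸ Submodule.subset_span ⟨j, rfl⟩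
    simpa [K, Fintype.linearCombination_apply] using this
  simp_rw [hφ, TensorProduct.sum_tmul, TensorProduct.smul_tmul]
  rw [Finset.sum_comm]
  simp_rw [← TensorProduct.tmul_sum, hker]
  simp

variable [IsNoetherianRing R]

/-- The inclusion of `A°` into `R^A`. -/
noncomputable def finiteDualToFun : finiteDual R A →ₗ[R] (A → R) :=
  LinearMap.ltoFun R A R R ∘ₗ (finiteDual R A).subtype

@[simp] theorem finiteDualToFun_apply (f : finiteDual R A) (a : A) :
    finiteDualToFun f a = (f : Module.Dual R A) a := rfl

theorem finiteDual_alphaCondition [hA : IsAlphaAlgebra R A] :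
    AlphaCondition (finiteDualPairing R A) := by
  intro M _ _
  have h : ∀ t, (alphaMap (finiteDualPairing R A) M t : A → M) =
      piTensorEval A M (LinearMap.rTensor M finiteDualToFun (TensorProduct.comm R _ _ t)) := by
    intro t
    induction t with
    | zero => ext; simp
    | tmul m f => ext a; simp
    | add x y hx hy => ext a; simp [hx, hy]
  intro s t hst
  refine (TensorProduct.comm R _ _).injective (hA.pure M (piTensorEval_injective A M ?_))
  exact (h s).symm.trans ((congrArg (fun g : A →ₗ[R] M => (g : A → M)) hst).trans (h t))

theorem finiteDual_tensor_ext [hA : IsAlphaAlgebra R A] {M : Type u} [AddCommMonoid M] [Module R M]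
    {s t : M ⊗[R] finiteDual R A}
    (h : ∀ a, alphaMap (finiteDualPairing R A) M s a = alphaMap (finiteDualPairing R A) M t a) :
    s = t :=
  finiteDual_alphaCondition.injective (LinearMap.ext h)

theorem exists_lift_of_pure {X P : Type u} [AddCommGroup P] [Module R P] (i : P →ₗ[R] (X → R))
    (hi : ∀ (N : Type u) [AddCommGroup N] [Module R N], Function.Injective (i.rTensor N))
    (t₀ : (X → R) ⊗[R] P)
    (h : ∀ x, (fun y => i (piTensorEval X P t₀ y) x) ∈ LinearMap.range i) :
    ∃ t, i.rTensor P t = t₀ := by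
  have hex : Function.Exact (i.rTensor P) ((LinearMap.range i).mkQ.rTensor P) :=
    rTensor_exact _ (LinearMap.exact_map_mkQ_range _) (Submodule.mkQ_surjective _)
  refine (hex t₀).1 ?_
  apply (TensorProduct.comm R _ _).injective
  apply hi
  apply piTensorEval_injective
  ext x
  have key : ∀ s : (X → R) ⊗[R] P, piTensorEval X _ (i.rTensor _
      (TensorProduct.comm R _ _ ((LinearMap.range i).mkQ.rTensor P s))) x =
      (LinearMap.range i).mkQ (fun y => i (piTensorEval X P s y) x) := by
    intro s
    induction s with
    | zero => simp; rfl
    | tmul m p =>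
      have e : (fun y => i (piTensorEval X P (m ⊗ₜ[R] p) y) x) = i p x • m := by
        ext y
        simp [mul_comm]
      rw [e, map_smul]
      rfl
    | add s t hs ht =>
      simp only [map_add, Pi.add_apply, hs, ht]
      rw [← map_add]
      rfl
  rw [key]
  have h0 : (LinearMap.range i).mkQ (fun y => i (piTensorEval X P t₀ y) x) = 0 :=
    (Submodule.Quotient.mk_eq_zero _).2 (h x)
  rw [h0]
  simp

theorem exists_comul [hA : IsAlphaAlgebra R A] (f : finiteDual R A) :
    ∃ t, alphaMap (finiteDualPairing R A) (finiteDual R A) t = leftTranslate.flip f := by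
  have hfg : (LinearMap.range (leftTranslate.flip f : A →ₗ[R] finiteDual R A)).FG := by
    have hle : (LinearMap.range (leftTranslate.flip f : A →ₗ[R] finiteDual R A)).map
        (finiteDual R A).subtype ≤ subbimoduleSpan R A f := by
      rintro _ ⟨_, ⟨a, rfl⟩, rfl⟩
      exact Submodule.subset_span ⟨(a, 1), rfl⟩
    exact Submodule.fg_of_fg_map_injective (finiteDual R A).subtype Subtype.val_injective
      (Submodule.FG.of_le (T := subbimoduleSpan R A f) f.2 hle)
  obtain ⟨n, w, hw⟩ := Submodule.fg_iff_exists_fin_generating_family.1 hfg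
  have hmem : ∀ y, leftTranslate y f ∈ Submodule.span R (Set.range w) := fun y =>
    hw ▸ ⟨y, rfl⟩
  choose c hc using fun y => (Submodule.mem_span_range_iff_exists_fun R).1 (hmem y)
  have hev : ∀ y, piTensorEval A (finiteDual R A) (∑ i, (fun y => c y i) ⊗ₜ w i) y =
      leftTranslate y f := by
    intro y
    rw [← hc y, map_sum, Finset.sum_apply]
    rfl
  obtain ⟨t, ht⟩ := exists_lift_of_pure finiteDualToFun hA.pure
    (∑ i, (fun y => c y i) ⊗ₜ w i) (fun x => by
      refine ⟨⟨biTranslate R A 1 x f, biTranslate_mem f.2 1 x⟩, ?_⟩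
      ext y
      rw [hev]
      simp)
  refine ⟨TensorProduct.comm R _ _ t, ?_⟩
  ext y : 1
  have h : ∀ s, alphaMap (finiteDualPairing R A) (finiteDual R A) (TensorProduct.comm R _ _ s) y =
      piTensorEval A (finiteDual R A) (LinearMap.rTensor _ finiteDualToFun s) y := by
    intro s
    induction s with
    | zero => simp
    | tmul m f => simp
    | add x y hx hy => simp [hx, hy]
  rw [h, ht, hev]
  rfl

/-- Comultiplication of `A°`: `∑ <a, f₂> f₁ = a f`, i.e. `f (x a) = ∑ f₁(x) f₂(a)`. -/
noncomputable def finiteDualComul [hA : IsAlphaAlgebra R A] :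
    finiteDual R A →ₗ[R] finiteDual R A ⊗[R] finiteDual R A :=
  linearChoice _ finiteDual_alphaCondition.injective leftTranslate.flip exists_comul

theorem alphaMap_finiteDualComul [hA : IsAlphaAlgebra R A] (f : finiteDual R A) (a : A) :
    alphaMap (finiteDualPairing R A) (finiteDual R A) (finiteDualComul f) a = leftTranslate a f :=
  LinearMap.congr_fun (linearChoice_spec _ _ _ _ f) a

/-- The counit of `A°`: `f ↦ f 1`. -/
noncomputable def finiteDualCounit : finiteDual R A →ₗ[R] R := finiteDualPairing R A 1

theorem alphaMap_lTensor_leftTranslate {M : Type u} [AddCommMonoid M] [Module R M]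
    (t : M ⊗[R] finiteDual R A) (z y : A) :
    alphaMap (finiteDualPairing R A) M ((leftTranslate z).lTensor M t) y =
      alphaMap (finiteDualPairing R A) M t (y * z) := by
  induction t with
  | zero => simp
  | tmul m c => simp
  | add x y hx hy => simp [hx, hy]

theorem finiteDualComul_leftTranslate [hA : IsAlphaAlgebra R A] (f : finiteDual R A) (z : A) :
    finiteDualComul (leftTranslate z f) = (leftTranslate z).lTensor _ (finiteDualComul f) := by
  refine finiteDual_tensor_ext fun y => ?_
  rw [alphaMap_lTensor_leftTranslate, alphaMap_finiteDualComul, alphaMap_finiteDualComul]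
  ext x
  simp [mul_assoc]

theorem alphaMap_assoc_symm_lTensor_comul [hA : IsAlphaAlgebra R A] {M : Type u} [AddCommMonoid M]
    [Module R M] (t : M ⊗[R] finiteDual R A) (z : A) :
    alphaMap (finiteDualPairing R A) (M ⊗[R] finiteDual R A)
      ((TensorProduct.assoc R M (finiteDual R A) (finiteDual R A)).symm
        (finiteDualComul.lTensor M t)) z = (leftTranslate z).lTensor M t := by
  have h' : ∀ (p : M) (t : finiteDual R A ⊗[R] finiteDual R A),
      alphaMap (finiteDualPairing R A) _ ((TensorProduct.assoc R _ _ _).symm (p ⊗ₜ t)) z =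
        p ⊗ₜ alphaMap (finiteDualPairing R A) _ t z := by
    intro p t
    induction t with
    | zero => simp
    | tmul m c => simp
    | add x y hx hy => simp [hx, hy, TensorProduct.tmul_add]
  induction t with
  | zero => simp
  | tmul m c => simp [h', alphaMap_finiteDualComul]
  | add x y hx hy => simp [hx, hy]

theorem rid_lTensor_finiteDualCounit {M : Type u} [AddCommMonoid M]
    [Module R M] (t : M ⊗[R] finiteDual R A) :
    TensorProduct.rid R M ((finiteDualCounit (R := R) (A := A)).lTensor M t) =
      alphaMap (finiteDualPairing R A) M t 1 := by
  induction t with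
  | zero => simp
  | tmul m c => simp [finiteDualCounit]
  | add x y hx hy => simp [hx, hy]

noncomputable instance finiteDual.instCoalgebra [hA : IsAlphaAlgebra R A] : Coalgebra R (finiteDual R A) where
  comul := finiteDualComul
  counit := finiteDualCounit
  coassoc := by
    ext f : 1
    apply (TensorProduct.assoc R _ _ _).symm.injective
    refine finiteDual_tensor_ext fun z => ?_
    simp only [LinearMap.comp_apply, LinearEquiv.coe_coe, LinearEquiv.symm_apply_apply]
    rw [alphaMap_assoc_symm_lTensor_comul, alphaMap_rTensor, alphaMap_finiteDualComul, finiteDualComul_leftTranslate]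
  rTensor_counit_comp_comul := by
    ext f : 1
    apply (TensorProduct.lid R _).injective
    ext y
    have h : ∀ t : finiteDual R A ⊗[R] finiteDual R A,
        (TensorProduct.lid R (finiteDual R A) (finiteDualCounit.rTensor _ t) : Module.Dual R A) y =
        (alphaMap (finiteDualPairing R A) _ t y : Module.Dual R A) 1 := by
      intro t
      induction t with
      | zero => simp
      | tmul m c => simp [finiteDualCounit, mul_comm]
      | add x y hx hy => simp [hx, hy]
    simp only [LinearMap.comp_apply]
    rw [h, alphaMap_finiteDualComul]
    simp
  lTensor_counit_comp_comul := by
    ext f : 1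
    apply (TensorProduct.rid R _).injective
    simp only [LinearMap.comp_apply]
    rw [rid_lTensor_finiteDualCounit, alphaMap_finiteDualComul]
    ext
    simp

theorem finiteDual_comul_def [hA : IsAlphaAlgebra R A] (f : finiteDual R A) (a : A) :
    alphaMap (finiteDualPairing R A) (finiteDual R A) (Coalgebra.comul (R := R) f) a =
      leftTranslate a f :=
  alphaMap_finiteDualComul f a

theorem finiteDual_counit_def [hA : IsAlphaAlgebra R A] (f : finiteDual R A) :
    Coalgebra.counit (R := R) f = (f : Module.Dual R A) 1 := rfl

end FiniteDual

section PullbackProduct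

variable {R : Type u} [CommRing R] [IsNoetherianRing R] {A B D : Type u} [Ring A] [Algebra R A]
  [Ring B] [Algebra R B] [Ring D] [Algebra R D]

theorem pullMul_mem (ρ : A →ₐ[R] B ⊗[R] D) {f : Module.Dual R B} {g : Module.Dual R D}
    (hf : f ∈ finiteDual R B) (hg : g ∈ finiteDual R D) :
    LinearMap.mul' R R ∘ₗ TensorProduct.map f g ∘ₗ ρ.toLinearMap ∈ finiteDual R A := by
  let cv : Module.Dual R B →ₗ[R] Module.Dual R D →ₗ[R] Module.Dual R A :=
    LinearMap.mk₂ R (fun f g => LinearMap.mul' R R ∘ₗ TensorProduct.map f g ∘ₗ ρ.toLinearMap)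
      (fun a b c => by ext; simp [TensorProduct.map_add_left])
      (fun r a c => by ext; simp [TensorProduct.map_smul_left])
      (fun a b c => by ext; simp [TensorProduct.map_add_right])
      (fun r a c => by ext; simp [TensorProduct.map_smul_right])
  refine Submodule.FG.of_le (T := Submodule.map₂ cv (subbimoduleSpan R B f)
    (subbimoduleSpan R D g)) (Submodule.FG.map₂ cv hf hg) (Submodule.span_le.2 ?_)
  rintro _ ⟨⟨a, b⟩, rfl⟩
  obtain ⟨k, p, q, hpq⟩ := TensorProduct.exists_sum_tmul_eq (ρ a)
  obtain ⟨l, r, s, hrs⟩ := TensorProduct.exists_sum_tmul_eq (ρ b)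
  have h : biTranslate R A a b (LinearMap.mul' R R ∘ₗ TensorProduct.map f g ∘ₗ ρ.toLinearMap) =
      ∑ j, ∑ i, cv (biTranslate R B (p i) (r j) f) (biTranslate R D (q i) (s j) g) := by
    ext x
    have hx : ∀ w : B ⊗[R] D, LinearMap.mul' R R (TensorProduct.map f g
        ((∑ j, r j ⊗ₜ[R] s j) * (w * ∑ i, p i ⊗ₜ[R] q i))) =
        ∑ j, ∑ i, LinearMap.mul' R R (TensorProduct.map (biTranslate R B (p i) (r j) f)
          (biTranslate R D (q i) (s j) g) w) := by
      intro w
      induction w with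
      | zero => simp
      | tmul c d => simp [Finset.sum_mul, Finset.mul_sum]; exact Finset.sum_comm
      | add c d hc hd => simp [add_mul, mul_add, hc, hd, Finset.sum_add_distrib]
    have := hx (ρ x)
    rw [← hpq, ← hrs, ← map_mul, ← map_mul] at this
    simpa [cv] using this
  simp only [h]
  exact Submodule.sum_mem _ fun j _ => Submodule.sum_mem _ fun i _ =>
    Submodule.apply_mem_map₂ cv (Submodule.subset_span ⟨(p i, r j), rfl⟩)
      (Submodule.subset_span ⟨(q i, s j), rfl⟩)

/-- For an algebra morphism `ρ : A → B ⊗ D`, the map `B° × D° → A°`, `(f, g) ↦ (f ⊗ g) ∘ ρ`. -/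
noncomputable def pullMul (ρ : A →ₐ[R] B ⊗[R] D) :
    finiteDual R B →ₗ[R] finiteDual R D →ₗ[R] finiteDual R A :=
  LinearMap.mk₂ R (fun f g => ⟨_, pullMul_mem ρ f.2 g.2⟩)
    (fun a b c => Subtype.ext <| by ext; simp [TensorProduct.map_add_left])
    (fun r a c => Subtype.ext <| by ext; simp [TensorProduct.map_smul_left])
    (fun a b c => Subtype.ext <| by ext; simp [TensorProduct.map_add_right])
    (fun r a c => Subtype.ext <| by ext; simp [TensorProduct.map_smul_right])

theorem pullMul_apply (ρ : A →ₐ[R] B ⊗[R] D) (f : finiteDual R B) (g : finiteDual R D) (a : A) :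
    (pullMul ρ f g : Module.Dual R A) a =
      LinearMap.mul' R R (TensorProduct.map (f : Module.Dual R B) (g : Module.Dual R D) (ρ a)) :=
  rfl

theorem leftTranslate_pullMul (ρ : A →ₐ[R] B ⊗[R] D) (f : finiteDual R B) (g : finiteDual R D)
    (a : A) : leftTranslate a (pullMul ρ f g) = TensorProduct.lift (pullMul ρ)
      (TensorProduct.map (leftTranslate.flip f) (leftTranslate.flip g) (ρ a)) := by
  ext x
  rw [leftTranslate_apply, pullMul_apply, map_mul]
  generalize ρ a = w
  induction w with
  | zero => simp
  | add w w' hw hw' => simp [mul_add, hw, hw']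
  | tmul y z =>
    rw [TensorProduct.map_tmul, TensorProduct.lift.tmul, pullMul_apply]
    generalize ρ x = w
    induction w with
    | zero => simp
    | add w w' hw hw' => simp [add_mul, hw, hw']
    | tmul y' z' => simp

/-- `(f, g) ↦ (f ⊗ g) ∘ ρ` is compatible with the comultiplications. -/
theorem comul_pullMul [IsAlphaAlgebra R A] [IsAlphaAlgebra R B] [IsAlphaAlgebra R D]
    (ρ : A →ₐ[R] B ⊗[R] D) (f : finiteDual R B) (g : finiteDual R D) :
    Coalgebra.comul (R := R) (pullMul ρ f g) =
      TensorProduct.map (TensorProduct.lift (pullMul ρ)) (TensorProduct.lift (pullMul ρ))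
        (TensorProduct.tensorTensorTensorComm R _ _ _ _
          (Coalgebra.comul (R := R) f ⊗ₜ[R] Coalgebra.comul (R := R) g)) := by
  refine finiteDual_tensor_ext fun y => ?_
  have h : ∀ (s : finiteDual R B ⊗[R] finiteDual R B) (t : finiteDual R D ⊗[R] finiteDual R D),
      alphaMap (finiteDualPairing R A) (finiteDual R A)
        (TensorProduct.map (TensorProduct.lift (pullMul ρ)) (TensorProduct.lift (pullMul ρ))
        (TensorProduct.tensorTensorTensorComm R _ _ _ _ (s ⊗ₜ[R] t))) y =
      TensorProduct.lift (pullMul ρ) (TensorProduct.map (alphaMap (finiteDualPairing R B) _ s)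
        (alphaMap (finiteDualPairing R D) _ t) (ρ y)) := by
    intro s t
    induction s with
    | zero => simp
    | add s s' hs hs' => simp [TensorProduct.add_tmul, hs, hs', TensorProduct.map_add_left]
    | tmul b f =>
      induction t with
      | zero => simp
      | add s s' hs hs' => simp [TensorProduct.tmul_add, hs, hs', TensorProduct.map_add_right]
      | tmul b' g =>
        rw [TensorProduct.tensorTensorTensorComm_tmul, TensorProduct.map_tmul, alphaMap_tmul,
          TensorProduct.lift.tmul, TensorProduct.lift.tmul, finiteDualPairing_apply, pullMul_apply]
        generalize ρ y = w
        induction w with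
        | zero => simp
        | add w w' hw hw' => simp [add_smul, hw, hw']
        | tmul x y => simp [mul_smul, smul_comm (f.1 x)]
  rw [h, finiteDual_comul_def, leftTranslate_pullMul]
  congr 3
  · ext1 y
    rw [finiteDual_comul_def]; rfl
  · ext1 y
    rw [finiteDual_comul_def]; rfl

end PullbackProduct

section FiniteDualBialgebra

open Coalgebra WithConv

variable {R : Type u} [CommRing R] [IsNoetherianRing R] {H : Type u} [Ring H] [Bialgebra R H]

theorem conv_mem {f g : Module.Dual R H} (hf : f ∈ finiteDual R H) (hg : g ∈ finiteDual R H) :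
    (toConv f * toConv g).ofConv ∈ finiteDual R H :=
  pullMul_mem (Bialgebra.comulAlgHom R H) hf hg

theorem counit_mem : counit ∈ finiteDual R H := by
  refine Submodule.FG.of_le (T := Submodule.span R {counit}) (Submodule.fg_span_singleton _)
    (Submodule.span_le.2 ?_)
  rintro _ ⟨⟨a, b⟩, rfl⟩
  refine Submodule.mem_span_singleton.2 ⟨counit (R := R) a * counit (R := R) b, ?_⟩
  ext x
  simp
  ring

/-- The finite dual of a bialgebra is a ring under the convolution product. -/
noncomputable instance finiteDual.instRing : Ring (finiteDual R H) where
  __ := (inferInstance : AddCommGroup (finiteDual R H))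
  mul f g := ⟨(toConv f.1 * toConv g.1).ofConv, conv_mem f.2 g.2⟩
  one := ⟨counit, counit_mem⟩
  mul_assoc f g h :=
    Subtype.ext (congrArg ofConv (mul_assoc (toConv f.1) (toConv g.1) (toConv h.1)))
  one_mul f := Subtype.ext (congrArg ofConv (one_mul (toConv f.1)))
  mul_one f := Subtype.ext (congrArg ofConv (mul_one (toConv f.1)))
  left_distrib f g h :=
    Subtype.ext (congrArg ofConv (mul_add (toConv f.1) (toConv g.1) (toConv h.1)))
  right_distrib f g h :=
    Subtype.ext (congrArg ofConv (add_mul (toConv f.1) (toConv g.1) (toConv h.1)))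
  zero_mul f := Subtype.ext (congrArg ofConv (zero_mul (toConv f.1)))
  mul_zero f := Subtype.ext (congrArg ofConv (mul_zero (toConv f.1)))

theorem finiteDual_mul_apply (f g : finiteDual R H) (x : H) :
    ((f * g : finiteDual R H) : Module.Dual R H) x =
      LinearMap.mul' R R (TensorProduct.map (f : Module.Dual R H) (g : Module.Dual R H)
        (comul x)) := rfl

theorem finiteDual_one_apply (x : H) :
    ((1 : finiteDual R H) : Module.Dual R H) x = counit x := rfl

noncomputable instance finiteDual.instAlgebra : Algebra R (finiteDual R H) :=
  Algebra.ofModule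
    (fun r f g => Subtype.ext (congrArg ofConv (smul_mul_assoc r (toConv f.1) (toConv g.1))))
    (fun r f g => Subtype.ext (congrArg ofConv (mul_smul_comm r (toConv f.1) (toConv g.1))))

/-- The map `B ⊗ H° → Hom(H, B)` is multiplicative for the convolution product. -/
theorem alphaMap_mul {B : Type u} [Ring B] [Algebra R B] (s t : B ⊗[R] finiteDual R H) (h : H) :
    alphaMap (finiteDualPairing R H) B (s * t) h =
      LinearMap.mul' R B (TensorProduct.map (alphaMap (finiteDualPairing R H) B s)
        (alphaMap (finiteDualPairing R H) B t) (comul h)) := by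
  induction s with
  | zero => simp
  | add s s' hs hs' => simp [add_mul, hs, hs', TensorProduct.map_add_left]
  | tmul b f =>
    induction t with
    | zero => simp
    | add s s' hs hs' => simp [mul_add, hs, hs', TensorProduct.map_add_right]
    | tmul b' g =>
      rw [Algebra.TensorProduct.tmul_mul_tmul, alphaMap_tmul, finiteDualPairing_apply,
        finiteDual_mul_apply]
      generalize comul (R := R) h = w
      induction w with
      | zero => simp
      | add w w' hw hw' => simp [add_smul, hw, hw']
      | tmul x y => simp [mul_smul, smul_comm (f.1 x)]

theorem leftTranslate_mul (f g : finiteDual R H) (h : H) :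
    leftTranslate h (f * g) = LinearMap.mul' R (finiteDual R H)
      (TensorProduct.map (leftTranslate.flip f) (leftTranslate.flip g) (comul h)) :=
  leftTranslate_pullMul (Bialgebra.comulAlgHom R H) f g h

variable [IsAlphaAlgebra R H]

/-- The finite dual of a bialgebra which is an α-algebra is a bialgebra. -/
noncomputable instance finiteDual.instBialgebra : Bialgebra R (finiteDual R H) :=
  Bialgebra.mk' R (finiteDual R H)
    (by rw [finiteDual_counit_def, finiteDual_one_apply, Bialgebra.counit_one])
    (by
      intro f g
      simp only [finiteDual_counit_def]
      rw [finiteDual_mul_apply, Bialgebra.comul_one, Algebra.TensorProduct.one_def]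
      simp)
    (by
      refine finiteDual_tensor_ext fun y => ?_
      rw [finiteDual_comul_def, Algebra.TensorProduct.one_def, alphaMap_tmul]
      ext x
      simp [finiteDual_one_apply, mul_comm])
    (by
      intro f g
      refine finiteDual_tensor_ext fun y => ?_
      rw [finiteDual_comul_def, alphaMap_mul, leftTranslate_mul]
      congr 3
      · ext1 y
        rw [finiteDual_comul_def]; rfl
      · ext1 y
        rw [finiteDual_comul_def]; rfl)

end FiniteDualBialgebra
/-! ### Doi-Koppinen structures and modules -/

/-- `ρ : M → M ⊗ C` is a (counital, coassociative) right coaction of the coalgebra `C`. -/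
structure IsRightCoaction {R : Type u} [CommRing R] {C M : Type u} [AddCommMonoid C] [Module R C]
    [Coalgebra R C] [AddCommMonoid M] [Module R M] (ρ : M →ₗ[R] M ⊗[R] C) : Prop where
  counit : ∀ m, TensorProduct.rid R M ((Coalgebra.counit (R := R) (A := C)).lTensor M (ρ m)) = m
  coassoc : ∀ m, TensorProduct.assoc R M C C (ρ.rTensor C (ρ m)) =
    (Coalgebra.comul (R := R) (A := C)).lTensor M (ρ m)

/-- A right-right Doi-Koppinen structure `(H, A, C)`: a bialgebra `H`, a right `H`-comodule
algebra `A` (the coaction is an algebra morphism) and a right `H`-module coalgebra `C` (the action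
is a coalgebra morphism). -/
structure DoiKoppinen (R H A C : Type u) [CommRing R] [Ring H] [Bialgebra R H] [Ring A]
    [Algebra R A] [AddCommGroup C] [Module R C] [Coalgebra R C] where
  coact : A →ₐ[R] A ⊗[R] H
  isRightCoaction : IsRightCoaction coact.toLinearMap
  act : C ⊗[R] H →ₗc[R] C
  act_one : ∀ c, act (c ⊗ₜ 1) = c
  act_mul : ∀ c h h', act (act (c ⊗ₜ h) ⊗ₜ h') = act (c ⊗ₜ (h * h'))

section Modules

variable {R H A C : Type u} [CommRing R] [Ring H] [Bialgebra R H] [Ring A]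
    [Algebra R A] [AddCommGroup C] [Module R C] [Coalgebra R C]

/-- The structure of a right-right Doi-Koppinen module on the `R`-module `M`: a right `A`-action
`act m a = m a` and a right `C`-coaction `ρ` such that
`ρ (m a) = ∑ m_<0> a_<0> ⊗ m_<1> a_<1>`. -/
structure DKModuleStr (S : DoiKoppinen R H A C) (M : Type u) [AddCommGroup M] [Module R M] where
  act : M →ₗ[R] A →ₗ[R] M
  act_one : ∀ m, act m 1 = m
  act_mul : ∀ m a b, act (act m a) b = act m (a * b)
  coact : M →ₗ[R] M ⊗[R] C
  isRightCoaction : IsRightCoaction coact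
  coact_act : ∀ m a, coact (act m a) =
    TensorProduct.map (TensorProduct.lift act) (S.act : C ⊗[R] H →ₗ[R] C)
      (TensorProduct.tensorTensorTensorComm R M C A H (coact m ⊗ₜ[R] S.coact a))

/-- Right-right Doi-Koppinen modules over `S = (H, A, C)`, the objects of `M(H)_A^C`. -/
structure DKModule (S : DoiKoppinen R H A C) where
  carrier : Type u
  [addCommGroup : AddCommGroup carrier]
  [module : Module R carrier]
  str : DKModuleStr S carrier

namespace DKModule

variable {S : DoiKoppinen R H A C}

instance : CoeSort (DKModule S) (Type u) := ⟨DKModule.carrier⟩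

attribute [instance] DKModule.addCommGroup DKModule.module

/-- The `A`-linear `C`-colinear maps. -/
@[ext] structure Hom (M N : DKModule S) where
  toLinearMap : M →ₗ[R] N
  map_act : ∀ m a, toLinearMap (M.str.act m a) = N.str.act (toLinearMap m) a
  map_coact : ∀ m, N.str.coact (toLinearMap m) = toLinearMap.rTensor C (M.str.coact m)

/-- The category `M(H)_A^C`. -/
instance : Category (DKModule S) where
  Hom M N := Hom M N
  id M := ⟨LinearMap.id, fun _ _ => rfl, fun m => by simp⟩
  comp f g := ⟨g.toLinearMap ∘ₗ f.toLinearMap,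
    fun m a => by simp [f.map_act, g.map_act],
    fun m => by simp [f.map_coact, g.map_coact, LinearMap.rTensor_comp_apply]⟩

/-- The linear map underlying a morphism. -/
def lin {M N : DKModule S} (f : M ⟶ N) : M →ₗ[R] N := Hom.toLinearMap f

theorem hom_ext {M N : DKModule S} {f g : M ⟶ N} (h : ∀ m, lin f m = lin g m) : f = g :=
  Hom.ext (LinearMap.ext h)

@[simp] theorem lin_id (M : DKModule S) (m : M) : lin (𝟙 M) m = m := rfl

@[simp] theorem lin_comp {M N P : DKModule S} (f : M ⟶ N) (g : N ⟶ P) (m : M) :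
    lin (f ≫ g) m = lin g (lin f m) := rfl

end DKModule

end Modules

/-! ### The dual Doi-Koppinen structure `(H°, C⁰, A°)` -/

section Dual

namespace DoiKoppinen

open WithConv

variable {R H A C : Type u} [CommRing R] [IsNoetherianRing R] [Ring H] [Bialgebra R H] [Ring A]
    [Algebra R A] [AddCommGroup C] [Module R C] [Coalgebra R C] (S : DoiKoppinen R H A C)

/-- The left `H`-action `(h g)(c) = g (c h)` on `C^*`. -/
noncomputable def dualAct : H →ₗ[R] Module.Dual R C →ₗ[R] Module.Dual R C :=
  dualAction (TensorProduct.curry (S.act : C ⊗[R] H →ₗ[R] C))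

@[simp] theorem dualAct_apply (h : H) (g : Module.Dual R C) (c : C) :
    S.dualAct h g c = g (S.act (c ⊗ₜ h)) := rfl

/-- `C⁰ = Rat^{H°}(_H C^*)`. -/
noncomputable def ratDual : Submodule R (Module.Dual R C) :=
  ratSubmodule (finiteDualPairing R H) S.dualAct

/-- The pairing between `C⁰` and `C`, `<g, c> = g c`. -/
noncomputable def ratDualPairing : S.ratDual →ₗ[R] C →ₗ[R] R := S.ratDual.subtype

variable {S}

theorem mem_ratDual {g : Module.Dual R C} : g ∈ S.ratDual ↔
    ∃ t : Module.Dual R C ⊗[R] finiteDual R H,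
      ∀ h, alphaMap (finiteDualPairing R H) _ t h = S.dualAct h g := by
  constructor
  · rintro ⟨t, ht⟩
    exact ⟨t, LinearMap.congr_fun ht⟩
  · rintro ⟨t, ht⟩
    exact ⟨t, LinearMap.ext ht⟩

theorem dualAct_mul (h h' : H) (g : Module.Dual R C) :
    S.dualAct h (S.dualAct h' g) = S.dualAct (h * h') g := by
  ext c
  simp [S.act_mul]

theorem dualAct_mem {g : Module.Dual R C} (hg : g ∈ S.ratDual) (h : H) :
    S.dualAct h g ∈ S.ratDual := by
  obtain ⟨t, ht⟩ := mem_ratDual.1 hg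
  refine mem_ratDual.2 ⟨(leftTranslate h).lTensor _ t, fun y => ?_⟩
  rw [alphaMap_lTensor_leftTranslate, ht, dualAct_mul]

theorem counit_act (c : C) (h : H) : Coalgebra.counit (R := R) (S.act (c ⊗ₜ h)) =
    Coalgebra.counit (R := R) c * Coalgebra.counit (R := R) h := by
  rw [CoalgHomClass.counit_comp_apply]
  simp [mul_comm]

theorem comul_act (c : C) (h : H) : Coalgebra.comul (R := R) (S.act (c ⊗ₜ h)) =
    TensorProduct.map (S.act : C ⊗[R] H →ₗ[R] C) (S.act : C ⊗[R] H →ₗ[R] C)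
      (TensorProduct.tensorTensorTensorComm R C C H H
        (Coalgebra.comul (R := R) c ⊗ₜ[R] Coalgebra.comul (R := R) h)) := by
  rw [← CoalgHomClass.map_comp_comul_apply]
  rfl

theorem counit_mem_ratDual : Coalgebra.counit ∈ S.ratDual := by
  refine mem_ratDual.2 ⟨Coalgebra.counit ⊗ₜ 1, fun h => ?_⟩
  ext c
  simp [counit_act, finiteDual_one_apply, mul_comm]

theorem dualAct_conv (h : H) (f g : Module.Dual R C) :
    toConv (S.dualAct h (toConv f * toConv g).ofConv) =
      LinearMap.mul' R (WithConv (C →ₗ[R] R)) (TensorProduct.map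
        ((WithConv.linearEquiv R (C →ₗ[R] R)).symm.toLinearMap ∘ₗ S.dualAct.flip f)
        ((WithConv.linearEquiv R (C →ₗ[R] R)).symm.toLinearMap ∘ₗ S.dualAct.flip g)
        (Coalgebra.comul (R := R) h)) := by
  ext c
  change (toConv f * toConv g) (S.act (c ⊗ₜ h)) = _
  rw [LinearMap.convMul_apply, comul_act]
  generalize Coalgebra.comul (R := R) h = w
  induction w with
  | zero => simp
  | add w w' hw hw' => simp [TensorProduct.tmul_add, hw, hw']
  | tmul y z =>
    rw [TensorProduct.map_tmul, LinearMap.mul'_apply, LinearMap.convMul_apply]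
    generalize Coalgebra.comul (R := R) c = w
    induction w with
    | zero => simp
    | add w w' hw hw' => simp [TensorProduct.add_tmul, hw, hw']
    | tmul y' z' => simp

theorem conv_mem_ratDual {f g : Module.Dual R C} (hf : f ∈ S.ratDual) (hg : g ∈ S.ratDual) :
    (toConv f * toConv g).ofConv ∈ S.ratDual := by
  obtain ⟨s, hs⟩ := mem_ratDual.1 hf
  obtain ⟨t, ht⟩ := mem_ratDual.1 hg
  let e : Module.Dual R C →ₗ[R] WithConv (C →ₗ[R] R) :=
    (WithConv.linearEquiv R (C →ₗ[R] R)).symm.toLinearMap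
  let e' : WithConv (C →ₗ[R] R) →ₗ[R] Module.Dual R C :=
    (WithConv.linearEquiv R (C →ₗ[R] R)).toLinearMap
  refine mem_ratDual.2 ⟨e'.rTensor _ (e.rTensor _ s * e.rTensor _ t), fun h => ?_⟩
  rw [alphaMap_rTensor, alphaMap_mul]
  have h1 : alphaMap (finiteDualPairing R H) _ (e.rTensor _ s) = e ∘ₗ S.dualAct.flip f := by
    ext1 y; rw [alphaMap_rTensor, hs]; rfl
  have h2 : alphaMap (finiteDualPairing R H) _ (e.rTensor _ t) = e ∘ₗ S.dualAct.flip g := by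
    ext1 y; rw [alphaMap_rTensor, ht]; rfl
  rw [h1, h2, ← dualAct_conv]
  rfl

/-- `C⁰` is a ring under the convolution product. -/
noncomputable instance ratDual.instRing : Ring S.ratDual where
  __ := (inferInstance : AddCommGroup S.ratDual)
  mul f g := ⟨(toConv f.1 * toConv g.1).ofConv, conv_mem_ratDual f.2 g.2⟩
  one := ⟨Coalgebra.counit, counit_mem_ratDual⟩
  mul_assoc f g h :=
    Subtype.ext (congrArg ofConv (mul_assoc (toConv f.1) (toConv g.1) (toConv h.1)))
  one_mul f := Subtype.ext (congrArg ofConv (one_mul (toConv f.1)))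
  mul_one f := Subtype.ext (congrArg ofConv (mul_one (toConv f.1)))
  left_distrib f g h :=
    Subtype.ext (congrArg ofConv (mul_add (toConv f.1) (toConv g.1) (toConv h.1)))
  right_distrib f g h :=
    Subtype.ext (congrArg ofConv (add_mul (toConv f.1) (toConv g.1) (toConv h.1)))
  zero_mul f := Subtype.ext (congrArg ofConv (zero_mul (toConv f.1)))
  mul_zero f := Subtype.ext (congrArg ofConv (mul_zero (toConv f.1)))

noncomputable instance ratDual.instAlgebra : Algebra R S.ratDual :=
  Algebra.ofModule
    (fun r f g => Subtype.ext (congrArg ofConv (smul_mul_assoc r (toConv f.1) (toConv g.1))))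
    (fun r f g => Subtype.ext (congrArg ofConv (mul_smul_comm r (toConv f.1) (toConv g.1))))

theorem ratDual_mul_apply (f g : S.ratDual) (c : C) :
    ((f * g : S.ratDual) : Module.Dual R C) c =
      LinearMap.mul' R R (TensorProduct.map (f : Module.Dual R C) (g : Module.Dual R C)
        (Coalgebra.comul (R := R) c)) := rfl

theorem ratDual_one_apply (c : C) :
    ((1 : S.ratDual) : Module.Dual R C) c = Coalgebra.counit (R := R) c := rfl

variable (S)

/-- The left `H`-action on `C⁰`. -/
noncomputable def ratDualAct : H →ₗ[R] S.ratDual →ₗ[R] S.ratDual :=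
  LinearMap.mk₂ R (fun h g => ⟨S.dualAct h g, dualAct_mem g.2 h⟩)
    (fun a b c => Subtype.ext <| by simp) (fun r a c => Subtype.ext <| by simp)
    (fun a b c => Subtype.ext <| by simp) (fun r a c => Subtype.ext <| by simp)

@[simp] theorem coe_ratDualAct (h : H) (g : S.ratDual) :
    (S.ratDualAct h g : Module.Dual R C) = S.dualAct h g := rfl

theorem ratDualAct_conv (h : H) (f g : S.ratDual) :
    S.ratDualAct h (f * g) = LinearMap.mul' R S.ratDual
      (TensorProduct.map (S.ratDualAct.flip f) (S.ratDualAct.flip g)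
        (Coalgebra.comul (R := R) h)) := by
  apply Subtype.ext
  apply toConv_injective
  refine (dualAct_conv h f.1 g.1).trans ?_
  generalize Coalgebra.comul (R := R) h = w
  induction w with
  | zero => simp
  | add w w' hw hw' => simp [hw, hw']
  | tmul y z => rfl

variable [IsAlphaAlgebra R H]

theorem exists_ratDual_coact (g : S.ratDual) :
    ∃ t, alphaMap (finiteDualPairing R H) S.ratDual t = S.ratDualAct.flip g := by
  obtain ⟨t, ht⟩ := mem_ratDual.1 g.2
  exact exists_alphaMap_eq finiteDual_alphaCondition S.ratDual (S.ratDualAct.flip g) t ht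

/-- The coaction of `H°` on `C⁰`: `∑ <h, g_<1>> g_<0> = h g`. -/
noncomputable def ratDualCoact : S.ratDual →ₗ[R] S.ratDual ⊗[R] finiteDual R H :=
  linearChoice _ finiteDual_alphaCondition.injective S.ratDualAct.flip S.exists_ratDual_coact

theorem alphaMap_ratDualCoact (g : S.ratDual) (h : H) :
    alphaMap (finiteDualPairing R H) S.ratDual (S.ratDualCoact g) h = S.ratDualAct h g :=
  LinearMap.congr_fun (linearChoice_spec _ _ _ _ g) h

/-- The Doi-Koppinen structure `(H°, C⁰, A°)` dual to `S = (H, A, C)`. The coaction of `H°` on `C⁰`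
is given by `∑ <h, g_<1>> g_<0> = h g` for `h ∈ H`, and the action of `H°` on `A°` by
`(f u)(a) = ∑ f (a_<0>) u (a_<1>)`. -/
noncomputable def dual [IsAlphaAlgebra R A] :
    DoiKoppinen R (finiteDual R H) S.ratDual (finiteDual R A) where
  coact := AlgHom.ofLinearMap S.ratDualCoact
    (by
      refine finiteDual_tensor_ext fun h => ?_
      rw [alphaMap_ratDualCoact, Algebra.TensorProduct.one_def, alphaMap_tmul]
      ext c
      simp [ratDual_one_apply, finiteDual_one_apply, counit_act, mul_comm])
    (by
      intro f g
      refine finiteDual_tensor_ext fun h => ?_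
      rw [alphaMap_ratDualCoact, alphaMap_mul, ratDualAct_conv]
      congr 3
      · ext1 y
        rw [alphaMap_ratDualCoact]; rfl
      · ext1 y
        rw [alphaMap_ratDualCoact]; rfl)
  isRightCoaction := by
    constructor
    · intro g
      refine (rid_lTensor_finiteDualCounit _).trans ((S.alphaMap_ratDualCoact g 1).trans ?_)
      ext c
      simp [S.act_one]
    · intro g
      apply (TensorProduct.assoc R _ _ _).symm.injective
      refine finiteDual_tensor_ext fun z => ?_
      rw [LinearEquiv.symm_apply_apply]
      refine Eq.trans ?_ (alphaMap_assoc_symm_lTensor_comul _ z).symm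
      refine (alphaMap_rTensor _ _ _ _).trans ?_
      refine (congrArg _ (S.alphaMap_ratDualCoact g z)).trans ?_
      refine finiteDual_tensor_ext fun y => ?_
      refine (S.alphaMap_ratDualCoact _ y).trans ?_
      refine Eq.trans ?_ (alphaMap_lTensor_leftTranslate _ z y).symm
      refine Eq.trans ?_ (S.alphaMap_ratDualCoact g (y * z)).symm
      exact Subtype.ext (dualAct_mul y z g.1)
  act :=
    { TensorProduct.lift (pullMul S.coact) with
      counit_comp := by
        ext f u
        change (pullMul S.coact f u : Module.Dual R A) 1 = _
        rw [pullMul_apply, map_one, Algebra.TensorProduct.one_def]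
        simp [finiteDual_counit_def, mul_comm]
      map_comp_comul := by
        ext f u : 3
        exact (comul_pullMul S.coact f u).symm }
  act_one f := by
    ext a
    change LinearMap.mul' R R (TensorProduct.map f.1 (Coalgebra.counit (R := R) (A := H))
      (S.coact a)) = f.1 a
    conv_rhs => rw [← S.isRightCoaction.counit a]
    change _ = f.1 (TensorProduct.rid R A (LinearMap.lTensor A _ (S.coact a)))
    generalize S.coact a = w
    induction w with
    | zero => simp
    | add w w' hw hw' => simp [hw, hw']
    | tmul y z => simp [mul_comm]
  act_mul f u v := by
    ext a
    have h1 : ∀ w : A ⊗[R] H, LinearMap.mul' R R (TensorProduct.map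
        (pullMul S.coact f u : Module.Dual R A) (v : Module.Dual R H) w) =
        LinearMap.mul' R R (TensorProduct.map (f : Module.Dual R A)
          (LinearMap.mul' R R ∘ₗ TensorProduct.map (u : Module.Dual R H) (v : Module.Dual R H))
          (TensorProduct.assoc R A H H (S.coact.toLinearMap.rTensor H w))) := by
      intro w
      induction w with
      | zero => simp
      | add w w' hw hw' => simp [hw, hw']
      | tmul y z =>
        rw [TensorProduct.map_tmul, pullMul_apply, LinearMap.rTensor_tmul]
        change _ = _
        simp only [AlgHom.toLinearMap_apply]
        generalize S.coact y = w
        induction w with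
        | zero => simp
        | add w w' hw hw' => simp_all [TensorProduct.add_tmul, add_mul]
        | tmul y' z' => simp [mul_assoc]
    have h2 : ∀ w : A ⊗[R] H, LinearMap.mul' R R (TensorProduct.map
        (f : Module.Dual R A) ((u * v : finiteDual R H) : Module.Dual R H) w) =
        LinearMap.mul' R R (TensorProduct.map (f : Module.Dual R A)
          (LinearMap.mul' R R ∘ₗ TensorProduct.map (u : Module.Dual R H) (v : Module.Dual R H))
          ((Coalgebra.comul (R := R) (A := H)).lTensor A w)) := by
      intro w
      induction w with
      | zero => simp
      | add w w' hw hw' => simp [hw, hw']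
      | tmul y z => rw [TensorProduct.map_tmul, finiteDual_mul_apply]; simp
    exact (h1 _).trans ((congrArg _ (congrArg _ (S.isRightCoaction.coassoc a))).trans (h2 _).symm)

end DoiKoppinen

/-! ### The two contravariant functors -/

section Functors

variable {R H A C : Type u} [CommRing R] [IsNoetherianRing R] [Ring H] [Bialgebra R H] [Ring A]
    [Algebra R A] [AddCommGroup C] [Module R C] [Coalgebra R C] [IsAlphaAlgebra R H]
    [IsAlphaAlgebra R A] {S : DoiKoppinen R H A C}

/-- `M⁰ = Rat^{A°}(_A M^*)`, where `(a f)(m) = f (m a)`. -/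
noncomputable def DKModule.zeroDual (M : DKModule S) : Submodule R (Module.Dual R M) :=
  ratSubmodule (finiteDualPairing R A) (dualAction M.str.act)

/-- `K^◇ = Rat^C(_{C⁰} K^*)`, where `(g f)(k) = f (k g)`. -/
noncomputable def DKModule.diamondDual (K : DKModule S.dual) : Submodule R (Module.Dual R K) :=
  ratSubmodule S.ratDualPairing (dualAction K.str.act)

variable (S)

/-- A contravariant functor `M ↦ M⁰` from `M(H)_A^C` to `M(H°)_{C⁰}^{A°}`:

* each `M⁰` is a Doi-Koppinen module over the dual structure, with the `C⁰`-action
  `(f g)(m) = ∑ f (m_<0>) g (m_<1>)` and the coaction with `∑ <a, f_<1>> f_<0> = a f`, `a ∈ A`;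
* each morphism `φ : M → N` restricts to a morphism `φ^* : N⁰ → M⁰`, `f ↦ f ∘ φ`. -/
structure ZeroDualFunctor where
  str : ∀ M : DKModule S, DKModuleStr S.dual M.zeroDual
  act_apply : ∀ (M : DKModule S) (f : M.zeroDual) (g : S.ratDual) (m : M),
    ((str M).act f g).1 m =
      LinearMap.mul' R R (TensorProduct.map f.1 g.1 (M.str.coact m))
  coact_apply : ∀ (M : DKModule S) (f : M.zeroDual) (a : A),
    (alphaMap (finiteDualPairing R A) M.zeroDual ((str M).coact f) a).1 =
      dualAction M.str.act a f.1
  map : ∀ {M N : DKModule S}, (M ⟶ N) →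
    ((⟨N.zeroDual, str N⟩ : DKModule S.dual) ⟶ (⟨M.zeroDual, str M⟩ : DKModule S.dual))
  map_apply : ∀ {M N : DKModule S} (φ : M ⟶ N) (f : N.zeroDual),
    (DKModule.lin (map φ) f : M.zeroDual).1 = f.1 ∘ₗ DKModule.lin φ

/-- A contravariant functor `K ↦ K^◇` from `M(H°)_{C⁰}^{A°}` to `M(H)_A^C`:

* each `K^◇` is a Doi-Koppinen module over `(H, A, C)`, with the `A`-action
  `(f a)(k) = ∑ f (k_<0>) k_<1>(a)` and the coaction with `∑ <g, f_<1>> f_<0> = g f`, `g ∈ C⁰`;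
* each morphism `φ : K → L` restricts to a morphism `φ^* : L^◇ → K^◇`, `f ↦ f ∘ φ`. -/
structure DiamondDualFunctor where
  str : ∀ K : DKModule S.dual, DKModuleStr S K.diamondDual
  act_apply : ∀ (K : DKModule S.dual) (f : K.diamondDual) (a : A) (k : K),
    ((str K).act f a).1 k =
      LinearMap.mul' R R (TensorProduct.map f.1 (finiteDualPairing R A a) (K.str.coact k))
  coact_apply : ∀ (K : DKModule S.dual) (f : K.diamondDual) (g : S.ratDual),
    (alphaMap S.ratDualPairing K.diamondDual ((str K).coact f) g).1 = dualAction K.str.act g f.1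
  map : ∀ {K L : DKModule S.dual}, (K ⟶ L) →
    ((⟨L.diamondDual, str L⟩ : DKModule S) ⟶ (⟨K.diamondDual, str K⟩ : DKModule S))
  map_apply : ∀ {K L : DKModule S.dual} (φ : K ⟶ L) (f : L.diamondDual),
    (DKModule.lin (map φ) f : K.diamondDual).1 = f.1 ∘ₗ DKModule.lin φ

variable {S}

/-- The underlying functor `M ↦ M⁰`, `φ ↦ φ^*`. -/
noncomputable def ZeroDualFunctor.toFunctor (F : ZeroDualFunctor S) :
    (DKModule S)ᵒᵖ ⥤ DKModule S.dual where
  obj M := ⟨M.unop.zeroDual, F.str M.unop⟩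
  map φ := F.map φ.unop
  map_id M := DKModule.hom_ext fun f => Subtype.ext <| (F.map_apply _ f).trans rfl
  map_comp φ χ := DKModule.hom_ext fun f => Subtype.ext <| by
    refine (F.map_apply _ f).trans ?_
    rw [DKModule.lin_comp]
    refine Eq.trans ?_ (F.map_apply _ _).symm
    exact (congrArg (· ∘ₗ DKModule.lin χ.unop) (F.map_apply φ.unop f)).symm

/-- The underlying functor `K ↦ K^◇`, `φ ↦ φ^*`. -/
noncomputable def DiamondDualFunctor.toFunctor (G : DiamondDualFunctor S) :
    (DKModule S.dual)ᵒᵖ ⥤ DKModule S where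
  obj K := ⟨K.unop.diamondDual, G.str K.unop⟩
  map φ := G.map φ.unop
  map_id K := DKModule.hom_ext fun f => Subtype.ext <| (G.map_apply _ f).trans rfl
  map_comp φ χ := DKModule.hom_ext fun f => Subtype.ext <| by
    refine (G.map_apply _ f).trans ?_
    rw [DKModule.lin_comp]
    refine Eq.trans ?_ (G.map_apply _ _).symm
    exact (congrArg (· ∘ₗ DKModule.lin χ.unop) (G.map_apply φ.unop f)).symm

end Functors

end Dual

/-! ### Coactions on rational submodules -/

section RationalElements

variable {R : Type u} [CommRing R] {B D : Type u} [AddCommMonoid B] [Module R B] [AddCommMonoid D]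
  [Module R D] {κ : B →ₗ[R] D →ₗ[R] R} {N : Type u} [AddCommMonoid N] [Module R N]
  {act : B →ₗ[R] N →ₗ[R] N}

/-! Let `B` be an algebra and `D` a coalgebra, paired so that `B → D^*` is an algebra morphism.
Every right `D`-comodule is then a left `B`-module by `b m = ∑ <b, m_<1>> m_<0>`. Under the
α-condition `M ⊗ D` embeds into `Hom(B, M)`, so the coaction is determined by the action, and an
identity between tensors may be checked after evaluation at each `b`. Coassociativity becomes
associativity of the action, and colinearity becomes `B`-linearity. Hence `Rat^D(_B N)` is a
`D`-comodule for every left `B`-module `N` (`ratCoact`, `isRightCoaction_ratCoact`).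

This applies to `M^*` with the pair `(A, A°)`, whose α-condition holds because `A` is an α-algebra,
and to `K^*` with the pair `(C⁰, C)`, whose α-condition is the hypothesis of the second part. The
other structure on the dual is the product `coactMul` of functionals, and its module axioms
transpose the comodule axioms.

After evaluation the Doi-Koppinen compatibility becomes `a (f g) = ∑ (a_<0> f) (a_<1> g)` in `M^*`,
and `g (f a) = ∑ ((a_<1> g) f) a_<0>` in `K^*`. Both transpose the compatibility on the given module
(`DKModuleStr.dualAction_coactMul`, `DKModuleStr.dualAction_coactMul_finiteDualPairing`). The same
formulas exhibit tensors showing that the products are rational.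

For the adjunction, a map `K → M^*` and a map `M → K^*` are both a bilinear form `β` on `K × M`. A
morphism `K → M⁰` amounts to `β(k g, m) = ∑ β(k, m_<0>) g(m_<1>)` and `β(k, m a) = ∑ β(k_<0>, m)
k_<1>(a)`. These are also the conditions for a morphism `M → K^◇`, with linearity and colinearity
interchanged. Rationality of the values follows from them, so flipping `β` is the bijection. -/

theorem mem_ratSubmodule {n : N} :
    n ∈ ratSubmodule κ act ↔ ∃ t : N ⊗[R] D, ∀ b, alphaMap κ N t b = act b n := by
  constructor
  · rintro ⟨t, ht⟩
    exact ⟨t, LinearMap.congr_fun ht⟩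
  · rintro ⟨t, ht⟩
    exact ⟨t, LinearMap.ext ht⟩

/-- The form in which the α-condition enters most arguments: identities between coactions are tested
after pairing with each `b`, where they turn into identities between actions. -/
theorem AlphaCondition.tensor_ext (hκ : AlphaCondition κ) {M : Type u} [AddCommMonoid M]
    [Module R M] {s t : M ⊗[R] D} (h : ∀ b, alphaMap κ M s b = alphaMap κ M t b) : s = t :=
  hκ.injective (LinearMap.ext h)

/-- The image of a `B`-linear map from a `D`-comodule consists of rational elements. -/
theorem map_mem_ratSubmodule {M : Type u} [AddCommMonoid M] [Module R M] {ρ : M →ₗ[R] M ⊗[R] D}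
    (φ : M →ₗ[R] N) (h : ∀ m b, act b (φ m) = φ (alphaMap κ M (ρ m) b)) (m : M) :
    φ m ∈ ratSubmodule κ act :=
  -- The coaction of `m`, pushed forward along `φ`, represents `b ↦ b φ(m)`; no α-condition is
  -- needed.
  mem_ratSubmodule.2 ⟨φ.rTensor D (ρ m), fun b => by rw [alphaMap_rTensor, h]⟩

/-- A `B`-linear map between `D`-comodules is colinear. -/
theorem AlphaCondition.map_coact (hκ : AlphaCondition κ) {M M' : Type u} [AddCommMonoid M]
    [Module R M] [AddCommMonoid M'] [Module R M'] (φ : M →ₗ[R] M') {ρ : M →ₗ[R] M ⊗[R] D}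
    {ρ' : M' →ₗ[R] M' ⊗[R] D}
    (h : ∀ m b, alphaMap κ M' (ρ' (φ m)) b = φ (alphaMap κ M (ρ m) b)) (m : M) :
    ρ' (φ m) = φ.rTensor D (ρ m) :=
  hκ.tensor_ext fun b => by rw [h, alphaMap_rTensor]

end RationalElements

/-! ### Comodules over `D` as modules over an algebra paired with `D`. -/

section Rational

variable {R : Type u} [CommRing R] {B D : Type u} [Ring B] [Algebra R B] [AddCommMonoid D]
  [Module R D] [Coalgebra R D]

/-- The map `B → D^*` induced by the pairing `κ : B × D → R` is an algebra morphism. -/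
structure IsAlgebraPairing (κ : B →ₗ[R] D →ₗ[R] R) : Prop where
  one : ∀ d, κ 1 d = Coalgebra.counit (R := R) d
  mul : ∀ b b' d, κ (b * b') d =
    LinearMap.mul' R R (TensorProduct.map (κ b) (κ b') (Coalgebra.comul (R := R) d))

variable {κ : B →ₗ[R] D →ₗ[R] R} {N : Type u} [AddCommGroup N] [Module R N]
  {act : B →ₗ[R] N →ₗ[R] N}

/-- The map `D → D`, `d ↦ ∑ <b, d₂> d₁`. -/
noncomputable def pairingTranslate (κ : B →ₗ[R] D →ₗ[R] R) (b : B) : D →ₗ[R] D :=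
  TensorProduct.rid R D ∘ₗ (κ b).lTensor D ∘ₗ Coalgebra.comul

/-- Multiplicativity of `B → D^*`, read as saying that `pairingTranslate κ b'` is the transpose of
right multiplication by `b'`. -/
theorem IsAlgebraPairing.apply_translate (h : IsAlgebraPairing κ) (b b' : B) (d : D) :
    κ b (pairingTranslate κ b' d) = κ (b * b') d := by
  rw [h.mul]
  simp only [pairingTranslate, LinearMap.comp_apply]
  generalize Coalgebra.comul (R := R) d = w
  induction w with
  | zero => simp
  | tmul x y => simp [mul_comm]
  | add x y hx hy => simp_all

theorem IsAlgebraPairing.alphaMap_lTensor_translate (h : IsAlgebraPairing κ) {M : Type u}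
    [AddCommMonoid M] [Module R M] (t : M ⊗[R] D) (b b' : B) :
    alphaMap κ M ((pairingTranslate κ b').lTensor M t) b = alphaMap κ M t (b * b') := by
  induction t with
  | zero => simp
  | tmul x y => simp [h.apply_translate]
  | add x y hx hy => simp [hx, hy]

/-- Handles the comultiplication side of coassociativity: pairing with `b` contracts only the last
factor, which leaves `d ↦ ∑ <b, d₂> d₁` on `D`. -/
theorem alphaMap_assoc_symm_lTensor_coalgebra_comul {M : Type u} [AddCommMonoid M] [Module R M]
    (t : M ⊗[R] D) (b : B) :
    alphaMap κ (M ⊗[R] D) ((TensorProduct.assoc R M D D).symm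
      ((Coalgebra.comul (R := R) (A := D)).lTensor M t)) b =
      (pairingTranslate κ b).lTensor M t := by
  have h' : ∀ (p : M) (s : D ⊗[R] D),
      alphaMap κ _ ((TensorProduct.assoc R M D D).symm (p ⊗ₜ s)) b =
        p ⊗ₜ TensorProduct.rid R D ((κ b).lTensor D s) := by
    intro p s
    induction s with
    | zero => simp
    | tmul m c => simp
    | add x y hx hy => simp [hx, hy, TensorProduct.tmul_add]
  induction t with
  | zero => simp
  | tmul m c => simp [h', pairingTranslate]
  | add x y hx hy => simp [hx, hy]

theorem IsAlgebraPairing.rid_lTensor_counit (h : IsAlgebraPairing κ) {M : Type u}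
    [AddCommMonoid M] [Module R M] (t : M ⊗[R] D) :
    TensorProduct.rid R M ((Coalgebra.counit (R := R) (A := D)).lTensor M t) =
      alphaMap κ M t 1 := by
  induction t with
  | zero => simp
  | tmul m c => simp [h.one]
  | add x y hx hy => simp [hx, hy]

/-- A map `ρ : M → M ⊗ D` inducing an action of `B` by `b m = ∑ <b, m_<1>> m_<0>` is a coaction. -/
theorem IsAlgebraPairing.isRightCoaction (h : IsAlgebraPairing κ) (hκ : AlphaCondition κ)
    {M : Type u} [AddCommMonoid M] [Module R M] (ρ : M →ₗ[R] M ⊗[R] D)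
    (h_one : ∀ m, alphaMap κ M (ρ m) 1 = m)
    (h_mul : ∀ m b b', alphaMap κ M (ρ (alphaMap κ M (ρ m) b')) b = alphaMap κ M (ρ m) (b * b')) :
    IsRightCoaction ρ where
  counit m := (h.rid_lTensor_counit _).trans (h_one m)
  coassoc m := by
    apply (TensorProduct.assoc R _ _ _).symm.injective
    -- The identity lives in `M ⊗ D ⊗ D`, so injectivity is used twice, once over `M ⊗ D` and once
    -- over `M`. What remains is `b (b' m) = (b b') m`.
    refine hκ.tensor_ext fun b' => ?_
    rw [LinearEquiv.symm_apply_apply, alphaMap_rTensor, alphaMap_assoc_symm_lTensor_coalgebra_comul]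
    refine hκ.tensor_ext fun b => ?_
    rw [h.alphaMap_lTensor_translate, h_mul]

/-- If `t` represents `y ↦ y n`, then translating its `D`-factor by `b` represents `y ↦ (y b) n = y
(b n)`. -/
theorem act_mem_ratSubmodule (h : IsAlgebraPairing κ)
    (h_mul : ∀ b b' n, act b (act b' n) = act (b * b') n) {n : N} (hn : n ∈ ratSubmodule κ act)
    (b : B) : act b n ∈ ratSubmodule κ act := by
  obtain ⟨t, ht⟩ := mem_ratSubmodule.1 hn
  exact mem_ratSubmodule.2 ⟨(pairingTranslate κ b).lTensor _ t, fun y => by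
    rw [h.alphaMap_lTensor_translate, ht, h_mul]⟩

/-- Rationality only provides a tensor in `N ⊗ D`. Since all `b n` are again rational, that tensor
dies in the quotient by the rational part tensored with `D`, by the α-condition there, and so comes
from the rational part. -/
theorem exists_ratSubmodule_coact (h : IsAlgebraPairing κ) (hκ : AlphaCondition κ)
    (h_mul : ∀ b b' n, act b (act b' n) = act (b * b') n) (n : ratSubmodule κ act) :
    ∃ t, alphaMap κ (ratSubmodule κ act) t =
      (act.flip.domRestrict (ratSubmodule κ act) n).codRestrict (ratSubmodule κ act)
        (fun b => act_mem_ratSubmodule h h_mul n.2 b) := by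
  obtain ⟨t, ht⟩ := mem_ratSubmodule.1 n.2
  exact exists_alphaMap_eq hκ _ _ t ht

/-- The coaction of `D` on `Rat^D(_B N)`: `∑ <b, n_<1>> n_<0> = b n`. -/
noncomputable def ratCoact (h : IsAlgebraPairing κ) (hκ : AlphaCondition κ)
    (h_mul : ∀ b b' n, act b (act b' n) = act (b * b') n) :
    ratSubmodule κ act →ₗ[R] ratSubmodule κ act ⊗[R] D :=
  linearChoice (alphaMap κ _) hκ.injective
    { toFun := fun n => (act.flip.domRestrict (ratSubmodule κ act) n).codRestrict
        (ratSubmodule κ act) (fun b => act_mem_ratSubmodule h h_mul n.2 b)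
      map_add' := fun m n => by ext; simp
      map_smul' := fun r n => by ext; simp }
    (exists_ratSubmodule_coact h hκ h_mul)

theorem coe_alphaMap_ratCoact (h : IsAlgebraPairing κ) (hκ : AlphaCondition κ)
    (h_mul : ∀ b b' n, act b (act b' n) = act (b * b') n) (n : ratSubmodule κ act) (b : B) :
    (alphaMap κ _ (ratCoact h hκ h_mul n) b : N) = act b n :=
  congrArg Subtype.val (LinearMap.congr_fun (linearChoice_spec _ _ _ _ n) b)

theorem isRightCoaction_ratCoact (h : IsAlgebraPairing κ) (hκ : AlphaCondition κ)
    (h_one : ∀ n, act 1 n = n) (h_mul : ∀ b b' n, act b (act b' n) = act (b * b') n) :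
    IsRightCoaction (ratCoact h hκ h_mul) :=
  h.isRightCoaction hκ _
    (fun m => Subtype.ext <| (coe_alphaMap_ratCoact h hκ h_mul m 1).trans (h_one _))
    (fun m b b' => Subtype.ext <| by
      rw [coe_alphaMap_ratCoact, coe_alphaMap_ratCoact, coe_alphaMap_ratCoact, h_mul])

end Rational

/-! ### The product of functionals on a comodule and on the coalgebra -/

section CoactMul

open WithConv

variable {R : Type u} [CommRing R] {C M : Type u} [AddCommMonoid C] [Module R C]
  [AddCommMonoid M] [Module R M]

/-- For `ρ : M → M ⊗ C`, the product `(f g)(m) = ∑ f (m_<0>) g (m_<1>)`. -/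
noncomputable def coactMul (ρ : M →ₗ[R] M ⊗[R] C) :
    Module.Dual R M →ₗ[R] Module.Dual R C →ₗ[R] Module.Dual R M :=
  LinearMap.mk₂ R (fun f g => LinearMap.mul' R R ∘ₗ TensorProduct.map f g ∘ₗ ρ)
    (fun a b c => by ext; simp [TensorProduct.map_add_left])
    (fun r a c => by ext; simp [TensorProduct.map_smul_left])
    (fun a b c => by ext; simp [TensorProduct.map_add_right])
    (fun r a c => by ext; simp [TensorProduct.map_smul_right])

theorem coactMul_apply (ρ : M →ₗ[R] M ⊗[R] C) (f : Module.Dual R M) (g : Module.Dual R C) (m : M) :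
    coactMul ρ f g m = LinearMap.mul' R R (TensorProduct.map f g (ρ m)) := rfl

/-- Multiplying `f` by the functional `<b, ->` is the same as precomposing `f` with the action of
`b`. This translates between the product formula for functionals and evaluated coactions. -/
theorem mul'_map_eq_apply_alphaMap {B : Type u} [AddCommMonoid B] [Module R B]
    (κ : B →ₗ[R] C →ₗ[R] R) (f : Module.Dual R M) (b : B) (t : M ⊗[R] C) :
    LinearMap.mul' R R (TensorProduct.map f (κ b) t) = f (alphaMap κ M t b) := by
  induction t with
  | zero => simp
  | tmul x y => simp [mul_comm]
  | add x y hx hy => simp [hx, hy]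

variable [Coalgebra R C] {ρ : M →ₗ[R] M ⊗[R] C}

theorem IsRightCoaction.coactMul_counit (hρ : IsRightCoaction ρ) (f : Module.Dual R M) :
    coactMul ρ f Coalgebra.counit = f := by
  ext m
  conv_rhs => rw [← hρ.counit m]
  rw [coactMul_apply]
  generalize ρ m = w
  induction w with
  | zero => simp
  | add w w' hw hw' => simp [hw, hw']
  | tmul y z => simp [mul_comm]

/-- Both sides apply `f ⊗ g ⊗ g'` to an iterated coaction of `m`, one to each side of the
coassociativity law. -/
theorem IsRightCoaction.coactMul_coactMul (hρ : IsRightCoaction ρ) (f : Module.Dual R M)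
    (g g' : Module.Dual R C) :
    coactMul ρ (coactMul ρ f g) g' = coactMul ρ f (toConv g * toConv g').ofConv := by
  ext m
  have h1 : ∀ w : M ⊗[R] C, LinearMap.mul' R R (TensorProduct.map (coactMul ρ f g) g' w) =
      LinearMap.mul' R R (TensorProduct.map f (LinearMap.mul' R R ∘ₗ TensorProduct.map g g')
        (TensorProduct.assoc R M C C (ρ.rTensor C w))) := by
    intro w
    induction w with
    | zero => simp
    | add w w' hw hw' => simp [hw, hw']
    | tmul y z =>
      rw [TensorProduct.map_tmul, coactMul_apply, LinearMap.rTensor_tmul]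
      generalize ρ y = w
      induction w with
      | zero => simp
      | add w w' hw hw' => simp_all [TensorProduct.add_tmul]
      | tmul y' z' => simp [mul_assoc]
  have h2 : ∀ w : M ⊗[R] C, LinearMap.mul' R R (TensorProduct.map f
      (toConv g * toConv g').ofConv w) =
      LinearMap.mul' R R (TensorProduct.map f (LinearMap.mul' R R ∘ₗ TensorProduct.map g g')
        ((Coalgebra.comul (R := R) (A := C)).lTensor M w)) := by
    intro w
    induction w with
    | zero => simp
    | add w w' hw hw' => simp [hw, hw']
    | tmul y z => rfl
  rw [coactMul_apply, coactMul_apply, h1, h2, hρ.coassoc]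

end CoactMul

/-! ### The dual of a right module as a left module. -/

section DualAction

variable {R : Type u} [CommRing R] {A M : Type u} [Ring A] [Algebra R A] [AddCommMonoid M]
  [Module R M] {act : M →ₗ[R] A →ₗ[R] M}

theorem dualAction_one (h : ∀ m, act m 1 = m) (f : Module.Dual R M) :
    dualAction act 1 f = f := by
  ext m
  simp [h]

theorem dualAction_dualAction (h : ∀ m a b, act (act m a) b = act m (a * b)) (a b : A)
    (f : Module.Dual R M) : dualAction act a (dualAction act b f) = dualAction act (a * b) f := by
  ext m
  simp [h]

end DualAction

/-- On a Doi-Koppinen module, `a (f g) = ∑ (a_<0> f) (a_<1> g)`. -/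
theorem DKModuleStr.dualAction_coactMul {R H A C : Type u} [CommRing R] [IsNoetherianRing R]
    [Ring H] [Bialgebra R H] [Ring A] [Algebra R A] [AddCommGroup C] [Module R C] [Coalgebra R C]
    {S : DoiKoppinen R H A C} {M : Type u} [AddCommGroup M] [Module R M] (σ : DKModuleStr S M)
    (a : A) (f : Module.Dual R M) (g : Module.Dual R C) :
    dualAction σ.act a (coactMul σ.coact f g) = TensorProduct.lift (coactMul σ.coact)
      (TensorProduct.map ((dualAction σ.act).flip f) (S.dualAct.flip g) (S.coact a)) := by
  ext m
  rw [dualAction_apply, coactMul_apply, σ.coact_act]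
  -- The Doi-Koppinen compatibility has now been used. Both sides are additive in the coactions of
  -- `a` and `m`, so each is replaced by an arbitrary tensor and reduced to pure tensors.
  generalize S.coact a = w
  induction w with
  | zero => simp
  | add w w' hw hw' => simp [TensorProduct.tmul_add, hw, hw']
  | tmul y z =>
    rw [TensorProduct.map_tmul, TensorProduct.lift.tmul, coactMul_apply]
    generalize σ.coact m = w
    induction w with
    | zero => simp
    | add w w' hw hw' => simp [TensorProduct.add_tmul, hw, hw']
    | tmul y' z' => simp

/-- Colinearity of `φ`, transposed: this makes `φ^*` linear for the product action, in both
functors. -/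
theorem DKModule.coactMul_lin {R H A C : Type u} [CommRing R] [Ring H] [Bialgebra R H] [Ring A]
    [Algebra R A] [AddCommGroup C] [Module R C] [Coalgebra R C] {S : DoiKoppinen R H A C}
    {M N : DKModule S} (φ : M ⟶ N) (f : Module.Dual R N)
    (g : Module.Dual R C) (m : M) : coactMul N.str.coact f g (DKModule.lin φ m) =
      coactMul M.str.coact (f ∘ₗ DKModule.lin φ) g m := by
  have h : N.str.coact (DKModule.lin φ m) = (DKModule.lin φ).rTensor C (M.str.coact m) :=
    φ.map_coact m
  rw [coactMul_apply, coactMul_apply, h, LinearMap.rTensor, TensorProduct.map_map,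
    LinearMap.comp_id]

/-! ### The two pairings, and the compatibility conditions evaluated against them. -/

section DoiKoppinenDual

variable {R H A C : Type u} [CommRing R] [IsNoetherianRing R] [Ring H] [Bialgebra R H] [Ring A]
    [Algebra R A] [AddCommGroup C] [Module R C] [Coalgebra R C]

/-- The comultiplication of `A°` was defined by `f (x a) = ∑ f₁(x) f₂(a)`, which is multiplicativity
of `A → (A°)^*`. -/
theorem finiteDual_isAlgebraPairing [IsAlphaAlgebra R A] :
    IsAlgebraPairing (finiteDualPairing R A) where
  one _ := rfl
  mul a b f := by
    rw [mul'_map_eq_apply_alphaMap, finiteDual_comul_def]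
    simp

theorem DoiKoppinen.ratDual_isAlgebraPairing (S : DoiKoppinen R H A C) :
    IsAlgebraPairing S.ratDualPairing where
  one _ := rfl
  mul _ _ _ := rfl

/-- Since `g (c h) = (h g)(c)`, the action of `H` on `C` moves to `g`. The map `β` is arbitrary
because the formula is needed with values in `K^*` and in `K^◇`. -/
theorem alphaMap_map_lift_act {S : DoiKoppinen R H A C} {P Q N : Type u} [AddCommMonoid P]
    [Module R P] [AddCommMonoid Q] [Module R Q] [AddCommMonoid N] [Module R N] (β : P →ₗ[R] Q →ₗ[R] N)
    (s : P ⊗[R] C) (t : Q ⊗[R] H) (g : S.ratDual) :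
    alphaMap S.ratDualPairing N (TensorProduct.map (TensorProduct.lift β)
      (S.act : C ⊗[R] H →ₗ[R] C)
      (TensorProduct.tensorTensorTensorComm R P C Q H (s ⊗ₜ[R] t))) g =
    TensorProduct.lift β.flip
      ((alphaMap S.ratDualPairing P s ∘ₗ S.ratDualAct.flip g).lTensor Q t) := by
  induction t with
  | zero => simp
  | add t t' ht ht' => simp [TensorProduct.tmul_add, ht, ht']
  | tmul q h =>
    rw [LinearMap.lTensor_tmul, TensorProduct.lift.tmul, LinearMap.flip_apply]
    induction s with
    | zero => simp
    | add s s' hs hs' => simp [TensorProduct.add_tmul, hs, hs']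
    | tmul p c => simp [DoiKoppinen.ratDualPairing]

variable [IsAlphaAlgebra R H] [IsAlphaAlgebra R A] {S : DoiKoppinen R H A C}

/-- Since `(f u)(a) = ∑ f (a_<0>) u (a_<1>)`, evaluation at `a` splits along the coaction of `a`. -/
theorem alphaMap_map_lift_dual_act {P Q N : Type u} [AddCommMonoid P] [Module R P] [AddCommMonoid Q]
    [Module R Q] [AddCommMonoid N] [Module R N] (β : P →ₗ[R] Q →ₗ[R] N)
    (s : P ⊗[R] finiteDual R A) (t : Q ⊗[R] finiteDual R H) (a : A) :
    alphaMap (finiteDualPairing R A) N (TensorProduct.map (TensorProduct.lift β)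
      (S.dual.act : finiteDual R A ⊗[R] finiteDual R H →ₗ[R] finiteDual R A)
      (TensorProduct.tensorTensorTensorComm R P (finiteDual R A) Q (finiteDual R H) (s ⊗ₜ[R] t))) a =
    TensorProduct.lift β (TensorProduct.map (alphaMap (finiteDualPairing R A) P s)
      (alphaMap (finiteDualPairing R H) Q t) (S.coact a)) := by
  induction s with
  | zero => simp
  | add s s' hs hs' => simp [TensorProduct.add_tmul, hs, hs', TensorProduct.map_add_left]
  | tmul p f =>
    induction t with
    | zero => simp
    | add s s' hs hs' => simp [TensorProduct.tmul_add, hs, hs', TensorProduct.map_add_right]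
    | tmul q g =>
      rw [TensorProduct.tensorTensorTensorComm_tmul, TensorProduct.map_tmul, alphaMap_tmul,
        TensorProduct.lift.tmul]
      change (pullMul S.coact f g : Module.Dual R A) a • _ = _
      rw [pullMul_apply]
      generalize S.coact a = w
      induction w with
      | zero => simp
      | add w w' hw hw' => simp [add_smul, hw, hw']
      | tmul x y => simp [mul_smul, smul_comm (f.1 x)]

/-- Acting by `u` on evaluation at `a` gives `∑ u(a_<1>)` times evaluation at `a_<0>`, so the result
is again an evaluation at an element of `A`. -/
theorem dual_dualAct_finiteDualPairing (u : finiteDual R H) (a : A) :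
    S.dual.dualAct u (finiteDualPairing R A a) =
      TensorProduct.lift ((LinearMap.lsmul R (Module.Dual R (finiteDual R A))).flip ∘ₗ
        finiteDualPairing R A) (u.1.lTensor A (S.coact a)) := by
  ext f
  rw [DoiKoppinen.dualAct_apply]
  change (pullMul S.coact f u : Module.Dual R A) a = _
  rw [pullMul_apply]
  generalize S.coact a = w
  induction w with
  | zero => simp
  | add w w' hw hw' => simp_all
  | tmul x y => simp [mul_comm]

/-- On a module over the dual structure, `g (f a) = ∑ ((a_<1> g) f) a_<0>` for `g ∈ C⁰`. -/
theorem DKModuleStr.dualAction_coactMul_finiteDualPairing {K : Type u} [AddCommGroup K]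
    [Module R K] (σ : DKModuleStr S.dual K) (g : S.ratDual) (f : Module.Dual R K) (a : A) :
    dualAction σ.act g (coactMul σ.coact f (finiteDualPairing R A a)) =
      TensorProduct.lift ((coactMul σ.coact ∘ₗ (dualAction σ.act).flip f).flip ∘ₗ
        finiteDualPairing R A) ((S.ratDualAct.flip g).lTensor A (S.coact a)) := by
  rw [σ.dualAction_coactMul]
  -- Here `t` stands for `∑ g_<0> ⊗ g_<1>`. The scalars `g_<1>(a_<1>)` are moved onto `g_<0>`, where
  -- they assemble to `a_<1> g`.
  have h : ∀ t : S.ratDual ⊗[R] finiteDual R H, TensorProduct.lift (coactMul σ.coact)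
      (TensorProduct.map ((dualAction σ.act).flip f)
        (S.dual.dualAct.flip (finiteDualPairing R A a)) t) =
      TensorProduct.lift ((coactMul σ.coact ∘ₗ (dualAction σ.act).flip f).flip ∘ₗ
        finiteDualPairing R A)
        ((alphaMap (finiteDualPairing R H) S.ratDual t).lTensor A (S.coact a)) := by
    intro t
    induction t with
    | zero => simp
    | add t t' ht ht' => simp [ht, ht', LinearMap.lTensor_add]
    | tmul g u =>
      rw [TensorProduct.map_tmul, TensorProduct.lift.tmul]
      change coactMul σ.coact _ (S.dual.dualAct u (finiteDualPairing R A a)) = _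
      rw [dual_dualAct_finiteDualPairing]
      generalize S.coact a = w
      induction w with
      | zero => simp
      | add w w' hw hw' => simp_all
      | tmul x y => simp
  have e : alphaMap (finiteDualPairing R H) S.ratDual (S.dual.coact g) = S.ratDualAct.flip g :=
    LinearMap.ext fun y => S.alphaMap_ratDualCoact g y
  exact (h _).trans (by rw [e])

end DoiKoppinenDual

/-! ### The functor `M ↦ M⁰`. -/

section ZeroDual

variable {R H A C : Type u} [CommRing R] [IsNoetherianRing R] [Ring H] [Bialgebra R H] [Ring A]
    [Algebra R A] [AddCommGroup C] [Module R C] [Coalgebra R C] [IsAlphaAlgebra R H]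
    [IsAlphaAlgebra R A] {S : DoiKoppinen R H A C}

namespace DKModule

variable (M : DKModule S)

/-- The `A°`-coaction on `M⁰`. -/
noncomputable def zeroDualCoact : M.zeroDual →ₗ[R] M.zeroDual ⊗[R] finiteDual R A :=
  ratCoact finiteDual_isAlgebraPairing finiteDual_alphaCondition
    (dualAction_dualAction M.str.act_mul)

theorem coe_alphaMap_zeroDualCoact (f : M.zeroDual) (a : A) :
    (alphaMap (finiteDualPairing R A) M.zeroDual (M.zeroDualCoact f) a).1 =
      dualAction M.str.act a f.1 :=
  coe_alphaMap_ratCoact _ _ _ f a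

/-- The right-hand side of the compatibility condition, evaluated at `a`, is `a (f g)`. With `N =
M^*` this proves that `f g` is rational; with `N = M⁰`, once the action exists, it proves the
compatibility itself. -/
theorem apply_alphaMap_zeroDualCoact {N : Type u} [AddCommMonoid N] [Module R N]
    (β : M.zeroDual →ₗ[R] S.ratDual →ₗ[R] N) (ι : N →ₗ[R] Module.Dual R M)
    (h : ∀ f g, ι (β f g) = coactMul M.str.coact f.1 g.1) (f : M.zeroDual) (g : S.ratDual) (a : A) :
    ι (alphaMap (finiteDualPairing R A) N (TensorProduct.map (TensorProduct.lift β)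
      (S.dual.act : finiteDual R A ⊗[R] finiteDual R H →ₗ[R] finiteDual R A)
      (TensorProduct.tensorTensorTensorComm R _ _ _ _
        (M.zeroDualCoact f ⊗ₜ[R] S.dual.coact g))) a) =
    dualAction M.str.act a (coactMul M.str.coact f.1 g.1) := by
  rw [alphaMap_map_lift_dual_act, M.str.dualAction_coactMul]
  generalize S.coact a = w
  induction w with
  | zero => simp
  | add w w' hw hw' => simp only [map_add, hw, hw']
  | tmul x y =>
    rw [TensorProduct.map_tmul, TensorProduct.map_tmul, TensorProduct.lift.tmul,
      TensorProduct.lift.tmul, h, coe_alphaMap_zeroDualCoact]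
    exact congrArg _ (congrArg Subtype.val (S.alphaMap_ratDualCoact g y))

theorem coactMul_mem_zeroDual (f : M.zeroDual) (g : S.ratDual) :
    coactMul M.str.coact f.1 g.1 ∈ M.zeroDual :=
  mem_ratSubmodule.2 ⟨_, M.apply_alphaMap_zeroDualCoact
    ((coactMul M.str.coact).domRestrict₁₂ M.zeroDual S.ratDual) LinearMap.id
    (fun _ _ => rfl) f g⟩

/-- The Doi-Koppinen module `M⁰` over the dual structure. -/
noncomputable def zeroDualStr : DKModuleStr S.dual M.zeroDual where
  act := LinearMap.mk₂ R (fun f g => ⟨_, M.coactMul_mem_zeroDual f g⟩)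
    (fun a b c => Subtype.ext <| by simp) (fun r a c => Subtype.ext <| by simp)
    (fun a b c => Subtype.ext <| by simp) (fun r a c => Subtype.ext <| by simp)
  act_one f := Subtype.ext <| M.str.isRightCoaction.coactMul_counit f.1
  act_mul f g g' := Subtype.ext <| M.str.isRightCoaction.coactMul_coactMul f.1 g.1 g'.1
  coact := M.zeroDualCoact
  isRightCoaction := isRightCoaction_ratCoact _ _ (dualAction_one M.str.act_one) _
  coact_act f g := finiteDual_tensor_ext fun a => Subtype.ext <|
    (M.coe_alphaMap_zeroDualCoact _ a).trans
      (M.apply_alphaMap_zeroDualCoact _ M.zeroDual.subtype (fun _ _ => rfl) f g a).symm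

end DKModule

theorem DKModule.comp_lin_mem_zeroDual {M N : DKModule S} (φ : M ⟶ N) (f : N.zeroDual) :
    f.1 ∘ₗ DKModule.lin φ ∈ M.zeroDual := by
  obtain ⟨t, ht⟩ := mem_ratSubmodule.1 f.2
  refine mem_ratSubmodule.2 ⟨(Module.Dual.transpose (DKModule.lin φ)).rTensor _ t, fun a => ?_⟩
  rw [alphaMap_rTensor, ht]
  ext m
  exact congrArg f.1 (φ.map_act m a).symm

variable (S)

/-- The contravariant functor `M ↦ M⁰`. -/
noncomputable def zeroDualFunctor : ZeroDualFunctor S where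
  str M := M.zeroDualStr
  act_apply _ _ _ _ := rfl
  coact_apply M f a := M.coe_alphaMap_zeroDualCoact f a
  map {M N} φ :=
    { toLinearMap := ((Module.Dual.transpose (DKModule.lin φ)).domRestrict N.zeroDual).codRestrict
        M.zeroDual (DKModule.comp_lin_mem_zeroDual φ)
      map_act := fun f g => Subtype.ext <| LinearMap.ext fun m => DKModule.coactMul_lin φ f.1 g.1 m
      -- `φ` is `A`-linear, so `φ^*` commutes with the left actions of `A`; by the α-condition it is
      -- then colinear.
      map_coact := finiteDual_alphaCondition.map_coact _ fun f a => Subtype.ext <| by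
        refine (M.coe_alphaMap_zeroDualCoact _ a).trans ?_
        ext m
        refine Eq.trans ?_ (LinearMap.congr_fun (N.coe_alphaMap_zeroDualCoact f a) _).symm
        exact congrArg f.1 (φ.map_act m a) }
  map_apply _ _ := rfl

end ZeroDual

/-! ### The functor `K ↦ K^◇`. -/

section DiamondDual

variable {R H A C : Type u} [CommRing R] [IsNoetherianRing R] [Ring H] [Bialgebra R H] [Ring A]
    [Algebra R A] [AddCommGroup C] [Module R C] [Coalgebra R C] [IsAlphaAlgebra R H]
    [IsAlphaAlgebra R A] {S : DoiKoppinen R H A C}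

namespace DKModule

variable (K : DKModule S.dual)

/-- The `C`-coaction on `K^◇`. -/
noncomputable def diamondDualCoact (hC : AlphaCondition S.ratDualPairing) :
    K.diamondDual →ₗ[R] K.diamondDual ⊗[R] C :=
  ratCoact S.ratDual_isAlgebraPairing hC (dualAction_dualAction K.str.act_mul)

theorem coe_alphaMap_diamondDualCoact (hC : AlphaCondition S.ratDualPairing)
    (f : K.diamondDual) (g : S.ratDual) :
    (alphaMap S.ratDualPairing K.diamondDual (K.diamondDualCoact hC f) g).1 =
      dualAction K.str.act g f.1 :=
  coe_alphaMap_ratCoact _ _ _ f g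

/-- Counterpart for `K^◇`, with the same double use: `N = K^*` gives rationality of `f a`, and `N =
K^◇` gives the compatibility. -/
theorem apply_alphaMap_diamondDualCoact (hC : AlphaCondition S.ratDualPairing)
    {N : Type u} [AddCommMonoid N] [Module R N]
    (β : K.diamondDual →ₗ[R] A →ₗ[R] N) (ι : N →ₗ[R] Module.Dual R K)
    (h : ∀ f a, ι (β f a) = coactMul K.str.coact f.1 (finiteDualPairing R A a))
    (f : K.diamondDual) (a : A) (g : S.ratDual) :
    ι (alphaMap S.ratDualPairing N (TensorProduct.map (TensorProduct.lift β)
      (S.act : C ⊗[R] H →ₗ[R] C)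
      (TensorProduct.tensorTensorTensorComm R _ _ _ _
        (K.diamondDualCoact hC f ⊗ₜ[R] S.coact a))) g) =
    dualAction K.str.act g (coactMul K.str.coact f.1 (finiteDualPairing R A a)) := by
  rw [alphaMap_map_lift_act, K.str.dualAction_coactMul_finiteDualPairing]
  generalize S.coact a = w
  induction w with
  | zero => simp
  | add w w' hw hw' => simp only [map_add, hw, hw']
  | tmul x y =>
    exact (h _ _).trans (congrArg (fun z => coactMul K.str.coact z (finiteDualPairing R A x))
      (K.coe_alphaMap_diamondDualCoact hC f (S.ratDualAct y g)))

theorem coactMul_mem_diamondDual (hC : AlphaCondition S.ratDualPairing)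
    (f : K.diamondDual) (a : A) :
    coactMul K.str.coact f.1 (finiteDualPairing R A a) ∈ K.diamondDual := by
  have h := K.apply_alphaMap_diamondDualCoact hC
    (((coactMul K.str.coact) ∘ₗ K.diamondDual.subtype).compl₂ (finiteDualPairing R A))
    LinearMap.id (fun f a => by rfl) f a
  exact mem_ratSubmodule.2 ⟨_, h⟩

/-- The Doi-Koppinen module `K^◇` over `S`. -/
noncomputable def diamondDualStr (hC : AlphaCondition S.ratDualPairing) :
    DKModuleStr S K.diamondDual where
  act := LinearMap.mk₂ R (fun f a => ⟨_, K.coactMul_mem_diamondDual hC f a⟩)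
    (fun a b c => Subtype.ext <| by simp) (fun r a c => Subtype.ext <| by simp)
    (fun a b c => Subtype.ext <| by simp) (fun r a c => Subtype.ext <| by simp)
  act_one f := Subtype.ext <| K.str.isRightCoaction.coactMul_counit f.1
  act_mul f a b := Subtype.ext <| by
    -- It remains to see that evaluations at `a` and `b` convolve to evaluation at `a * b` on `A°`.
    refine (K.str.isRightCoaction.coactMul_coactMul f.1 _ _).trans (congrArg _ ?_)
    ext u
    exact (finiteDual_isAlgebraPairing.mul a b u).symm
  coact := K.diamondDualCoact hC
  isRightCoaction := isRightCoaction_ratCoact _ _ (dualAction_one K.str.act_one) _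
  coact_act f a := hC.tensor_ext fun g => Subtype.ext <|
    (K.coe_alphaMap_diamondDualCoact hC _ g).trans
      (K.apply_alphaMap_diamondDualCoact hC _ K.diamondDual.subtype (fun _ _ => rfl) f a g).symm

end DKModule

theorem DKModule.comp_lin_mem_diamondDual {K L : DKModule S.dual} (φ : K ⟶ L)
    (f : L.diamondDual) : f.1 ∘ₗ DKModule.lin φ ∈ K.diamondDual := by
  obtain ⟨t, ht⟩ := mem_ratSubmodule.1 f.2
  refine mem_ratSubmodule.2 ⟨(Module.Dual.transpose (DKModule.lin φ)).rTensor _ t, fun a => ?_⟩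
  rw [alphaMap_rTensor, ht]
  ext m
  exact congrArg f.1 (φ.map_act m a).symm

/-- The contravariant functor `K ↦ K^◇`. -/
noncomputable def diamondDualFunctor (hC : AlphaCondition S.ratDualPairing) :
    DiamondDualFunctor S where
  str K := K.diamondDualStr hC
  act_apply _ _ _ _ := rfl
  coact_apply K f g := K.coe_alphaMap_diamondDualCoact hC f g
  map {K L} φ :=
    { toLinearMap := ((Module.Dual.transpose (DKModule.lin φ)).domRestrict
        L.diamondDual).codRestrict K.diamondDual (DKModule.comp_lin_mem_diamondDual φ)
      map_act := fun f a => Subtype.ext <| LinearMap.ext fun k =>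
        DKModule.coactMul_lin φ f.1 (finiteDualPairing R A a) k
      map_coact := hC.map_coact _ fun f g => Subtype.ext <| by
        refine (K.coe_alphaMap_diamondDualCoact hC _ g).trans ?_
        ext k
        refine Eq.trans ?_ (LinearMap.congr_fun (L.coe_alphaMap_diamondDualCoact hC f g) _).symm
        exact congrArg f.1 (φ.map_act k g) }
  map_apply _ _ := rfl

end DiamondDual

/-! ### The adjunction, by flipping bilinear forms on `K × M`. -/

section Adjunction

variable {R H A C : Type u} [CommRing R] [IsNoetherianRing R] [Ring H] [Bialgebra R H] [Ring A]
    [Algebra R A] [AddCommGroup C] [Module R C] [Coalgebra R C] [IsAlphaAlgebra R H]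
    [IsAlphaAlgebra R A] {S : DoiKoppinen R H A C} (hC : AlphaCondition S.ratDualPairing)
    {M : DKModule S} {K : DKModule S.dual}

/-- The linear map `M → K^*` underlying the transpose of a morphism `K → M⁰`. -/
noncomputable def toDiamondDualAux (φ : K ⟶ (zeroDualFunctor S).toFunctor.obj (.op M)) :
    M →ₗ[R] Module.Dual R K :=
  (M.zeroDual.subtype ∘ₗ (DKModule.lin φ : K →ₗ[R] M.zeroDual)).flip

/-- The `C⁰`-linearity of `φ`, read in the variable `m`. It yields both the rationality of the
values of the transpose and its `C`-colinearity. -/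
theorem dualAction_toDiamondDualAux (φ : K ⟶ (zeroDualFunctor S).toFunctor.obj (.op M)) (m : M)
    (g : S.ratDual) : dualAction K.str.act g (toDiamondDualAux φ m) =
      toDiamondDualAux φ (alphaMap S.ratDualPairing M (M.str.coact m) g) := by
  ext k
  have h := LinearMap.congr_fun (congrArg Subtype.val (φ.map_act k g)) m
  exact h.trans (mul'_map_eq_apply_alphaMap S.ratDualPairing _ g _)

/-- The `A°`-colinearity of `φ`, evaluated at `a` and `m`, becomes `A`-linearity of the transpose.
-/
theorem toDiamondDualAux_act (φ : K ⟶ (zeroDualFunctor S).toFunctor.obj (.op M)) (m : M)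
    (a : A) : toDiamondDualAux φ (M.str.act m a) =
      coactMul K.str.coact (toDiamondDualAux φ m) (finiteDualPairing R A a) := by
  ext k
  have h := congrArg (fun t => (alphaMap (finiteDualPairing R A) M.zeroDual t a).1 m)
    (φ.map_coact k)
  have h1 := LinearMap.congr_fun (M.coe_alphaMap_zeroDualCoact (DKModule.lin φ k) a) m
  refine (h1.symm.trans h).trans ?_
  rw [coactMul_apply, mul'_map_eq_apply_alphaMap]
  exact congrArg (fun f : M.zeroDual => f.1 m) (alphaMap_rTensor _ _ _ _)

/-- The transpose `M → K^◇` of a morphism `K → M⁰`. -/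
noncomputable def toDiamondDual (φ : K ⟶ (zeroDualFunctor S).toFunctor.obj (.op M)) :
    M ⟶ (diamondDualFunctor hC).toFunctor.obj (.op K) where
  toLinearMap := (toDiamondDualAux φ).codRestrict K.diamondDual
    (map_mem_ratSubmodule _ (dualAction_toDiamondDualAux φ))
  map_act m a := Subtype.ext <| toDiamondDualAux_act φ m a
  map_coact := hC.map_coact _ fun m g => Subtype.ext <|
    (K.coe_alphaMap_diamondDualCoact hC _ g).trans (dualAction_toDiamondDualAux φ m g)

/-- The linear map `K → M^*` underlying the transpose of a morphism `M → K^◇`. -/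
noncomputable def toZeroDualAux (ψ : M ⟶ (diamondDualFunctor hC).toFunctor.obj (.op K)) :
    K →ₗ[R] Module.Dual R M :=
  (K.diamondDual.subtype ∘ₗ (DKModule.lin ψ : M →ₗ[R] K.diamondDual)).flip

/-- The `A`-linearity of `ψ`, read in the variable `k`; it yields rationality and `A°`-colinearity
of the transpose. -/
theorem dualAction_toZeroDualAux (ψ : M ⟶ (diamondDualFunctor hC).toFunctor.obj (.op K)) (k : K)
    (a : A) : dualAction M.str.act a (toZeroDualAux hC ψ k) =
      toZeroDualAux hC ψ (alphaMap (finiteDualPairing R A) K (K.str.coact k) a) := by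
  ext m
  have h := LinearMap.congr_fun (congrArg Subtype.val (ψ.map_act m a)) k
  exact h.trans (mul'_map_eq_apply_alphaMap (finiteDualPairing R A) _ a _)

/-- The `C`-colinearity of `ψ`, evaluated at `g` and `k`, becomes `C⁰`-linearity of the transpose.
-/
theorem toZeroDualAux_act (ψ : M ⟶ (diamondDualFunctor hC).toFunctor.obj (.op K)) (k : K)
    (g : S.ratDual) : toZeroDualAux hC ψ (K.str.act k g) =
      coactMul M.str.coact (toZeroDualAux hC ψ k) g.1 := by
  ext m
  have h := congrArg (fun t => (alphaMap S.ratDualPairing K.diamondDual t g).1 k)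
    (ψ.map_coact m)
  have h1 := LinearMap.congr_fun (K.coe_alphaMap_diamondDualCoact hC (DKModule.lin ψ m) g) k
  refine (h1.symm.trans h).trans ?_
  refine Eq.trans ?_ (mul'_map_eq_apply_alphaMap S.ratDualPairing _ g _).symm
  exact congrArg (fun f : K.diamondDual => f.1 k) (alphaMap_rTensor _ _ _ _)

/-- The transpose `K → M⁰` of a morphism `M → K^◇`. -/
noncomputable def toZeroDual (ψ : M ⟶ (diamondDualFunctor hC).toFunctor.obj (.op K)) :
    K ⟶ (zeroDualFunctor S).toFunctor.obj (.op M) where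
  toLinearMap := (toZeroDualAux hC ψ).codRestrict M.zeroDual
    (map_mem_ratSubmodule _ (dualAction_toZeroDualAux hC ψ))
  map_act k g := Subtype.ext <| toZeroDualAux_act hC ψ k g
  map_coact := finiteDual_alphaCondition.map_coact _ fun k a => Subtype.ext <|
    (M.coe_alphaMap_zeroDualCoact _ a).trans (dualAction_toZeroDualAux hC ψ k a)

/-- The functors `(-)⁰` and `(-)^◇` are adjoint on the right. -/
noncomputable def zeroDualAdjunction :
    (zeroDualFunctor S).toFunctor.rightOp ⊣ (diamondDualFunctor hC).toFunctor :=
  Adjunction.mkOfHomEquiv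
    { homEquiv := fun _ _ =>
        { toFun := fun φ => toDiamondDual hC φ.unop
          invFun := fun ψ => (toZeroDual hC ψ).op
          -- Both transposes flip the same bilinear form, so inverses and naturality hold by
          -- definition.
          left_inv := fun _ => rfl
          right_inv := fun _ => rfl }
      homEquiv_naturality_left_symm := fun _ _ => rfl
      homEquiv_naturality_right := fun _ _ => rfl }

end Adjunction

theorem mainTheorem4 {R H A C : Type u} [CommRing R] [IsNoetherianRing R] [Ring H]
    [Bialgebra R H] [Ring A] [Algebra R A] [AddCommGroup C] [Module R C] [Coalgebra R C]
    [IsAlphaAlgebra R H] [IsAlphaAlgebra R A] (S : DoiKoppinen R H A C) :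
    ∃ F : ZeroDualFunctor S,
      AlphaCondition S.ratDualPairing →
        ∃ G : DiamondDualFunctor S, Nonempty (F.toFunctor.rightOp ⊣ G.toFunctor) :=
  ⟨zeroDualFunctor S, fun hC => ⟨diamondDualFunctor hC, ⟨zeroDualAdjunction hC⟩⟩⟩
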